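/- **Syntax.** Let $P$, $X$, $Y$ be sets of atoms, $\nu$-variables and $\mu$-variables ($X$, $Y$ disjoint). Formulas are given by $$\varphi ::= p \mid x \mid y \mid \bot \mid \top \mid \varphi\vee\varphi \mid \varphi\wedge\varphi \mid \Box\varphi \mid \Diamond\varphi \mid \mu y.\varphi \mid \nu x.\varphi \qquad (p\in P,\ x\in X,\ y\in Y).$$ A formula $\varphi$ is *clean* if no variable is both free and bound in $\varphi$ and for every bound variable $z$ there is a unique formula $\psi_z$ such that $\eta z.\psi_z$ is a subformula of $\varphi$ (where $\eta=\nu$ if $z\in X$ and $\eta=\mu$ if $z\in Y$). For bound variables of $\varphi$ put $z_1\le_\varphi z_2$ iff $z_2$ occurs freely in $\psi_{z_1}$. **Semantics.** Let $\mathbb F=(G,M,I,R_\Box,R_\Diamond)$ be an enriched polarity: $G,M$ are sets, $I,R_\Box\subseteq G\times M$, $R_\Diamond\subseteq M\times G$, and for all $g\in G$, $m\in M$ the sets $\{g'\mid g'R_\Box m\}$, $\{m'\mid gR_\Box m'\}$, $\{m'\mid m'R_\Diamond g\}$, $\{g'\mid mR_\Diamond g'\}$ are Galois-stable with respect to $I$.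 Let $\mathbb P^+$ be the complete lattice of formal concepts $c=([\![c]\!],(\![c]\!))$ (extension, intension) of $(G,M,I)$. Let $\Box c$ be the concept with extension $\{g\mid \forall m\in(\![c]\!),\ gR_\Box m\}$ and $\Diamond c$ the concept with intension $\{m\mid\forall g\in[\![c]\!],\ mR_\Diamond g\}$. A valuation $V$ assigning a concept to every atom and to every variable extends to all formulas, with $\bot,\top,\vee,\wedge$ interpreted by the lattice operations of $\mathbb P^+$, and with $\mu y.\varphi$ and $\nu x.\varphi$ interpreted as the least and the greatest fixed point of the monotone map $c\mapsto V[y\mapsto c](\varphi)$, respectively $c\mapsto V[x\mapsto c](\varphi)$. Write $g\Vdash\varphi$ iff $g$ is in the extension, and $m\succ\varphi$ iff $m$ is in the intension, of $V(\varphi)$. **Evaluation game.** For a clean formula $\varphi$ the positions are pairs $(g,\psi)$, at which $\forall$ moves, and $(m,\psi)$, at which $\exists$ moves, with $g\in G$, $m\in M$. Write $I^c$, $R_\Box^c$, $R_\Diamond^c$ for the complements. The admissible moves are: * for $a$ an atom or a variable that is not bound in $\varphi$: from $(g,a)$ none if $g\Vdash a$, and otherwise all $(m,a)$ with $gI^cm$;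 from $(m,a)$ none if $m\succ a$, and otherwise all $(g,a)$ with $gI^cm$; * from $(g,\top)$ and $(m,\bot)$: none; from $(m,\top)$: all $(g,\top)$ with $gI^cm$; from $(g,\bot)$: all $(m,\bot)$ with $gI^cm$; * from $(m,\psi_1\vee\psi_2)$: $(m,\psi_1)$, $(m,\psi_2)$; from $(g,\psi_1\vee\psi_2)$: all $(m,\psi_1\vee\psi_2)$ with $gI^cm$; * from $(g,\psi_1\wedge\psi_2)$: $(g,\psi_1)$, $(g,\psi_2)$; from $(m,\psi_1\wedge\psi_2)$: all $(g,\psi_1\wedge\psi_2)$ with $gI^cm$; * from $(m,\Diamond\psi)$: all $(g,\psi)$ with $mR_\Diamond^cg$; from $(g,\Diamond\psi)$: all $(m,\Diamond\psi)$ with $gI^cm$; * from $(g,\Box\psi)$: all $(m,\psi)$ with $gR_\Box^cm$; from $(m,\Box\psi)$: all $(g,\Box\psi)$ with $gI^cm$; * from $(g,\nu x.\psi)$: $(g,\psi)$; from $(m,\nu x.\psi)$: all $(g,\nu x.\psi)$ with $gI^cm$; from $(m,\mu y.\psi)$: $(m,\psi)$; from $(g,\mu y.\psi)$: all $(m,\mu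 y.\psi)$ with $gI^cm$; * for variables $x\in X$, $y\in Y$ bound in $\varphi$: from $(g,x)$: $(g,\nu x.\psi_x)$; from $(m,x)$: all $(g,x)$ with $gI^cm$; from $(m,y)$: $(m,\mu y.\psi_y)$; from $(g,y)$: all $(m,y)$ with $gI^cm$. A player who has to move and has no admissible move loses. An infinite play is won by $\exists$ if the $\le_\varphi$-maximal variable among the bound variables of $\varphi$ that are repeated infinitely often is a $\nu$-variable, and by $\forall$ otherwise (in particular if no bound variable is repeated infinitely often). A strategy may depend on the whole history of the play. **Theorem.** For every enriched polarity, every valuation $V$, every clean formula $\varphi$, every $g\in G$ and every $m\in M$: $g\Vdash\varphi$ if and only if $\exists$ has a winning strategy in this game from $(g,\varphi)$, and $m\not\succ\varphi$ if and only if $\exists$ has a winning strategy in this game from $(m,\varphi)$. -/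

import Mathlib

namespace NDMu

open Order

/-! ### Syntax -/

/-- Formulas over atoms `P`, greatest fixed point variables `X` and least fixed point variables `Y`.
A variable is an element of `X ⊕ Y`. -/
inductive Formula (P X Y : Type*) where
  | atom (p : P)
  | var (z : X ⊕ Y)
  | bot
  | top
  | or (φ ψ : Formula P X Y)
  | and (φ ψ : Formula P X Y)
  | box (φ : Formula P X Y)
  | dia (φ : Formula P X Y)
  | mu (y : Y) (φ : Formula P X Y)
  | nu (x : X) (φ : Formula P X Y)

namespace Formula

variable {P X Y : Type*}

/-- `η z. φ`: this is `ν x. φ` for `x ∈ X` and `μ y. φ` for `y ∈ Y`. -/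
def fix : X ⊕ Y → Formula P X Y → Formula P X Y
  | .inl x, φ => nu x φ
  | .inr y, φ => mu y φ

/-- The variables with a free occurrence. -/
def freeVars : Formula P X Y → Set (X ⊕ Y)
  | atom _ => ∅
  | var z => {z}
  | bot => ∅
  | top => ∅
  | or φ ψ => φ.freeVars ∪ ψ.freeVars
  | and φ ψ => φ.freeVars ∪ ψ.freeVars
  | box φ => φ.freeVars
  | dia φ => φ.freeVars
  | mu y φ => φ.freeVars \ {.inr y}
  | nu x φ => φ.freeVars \ {.inl x}

/-- The subformulas, the formula itself included. -/
def subformulas : Formula P X Y → Set (Formula P X Y)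
  | atom p => {atom p}
  | var z => {var z}
  | bot => {bot}
  | top => {top}
  | or φ ψ => {or φ ψ} ∪ (φ.subformulas ∪ ψ.subformulas)
  | and φ ψ => {and φ ψ} ∪ (φ.subformulas ∪ ψ.subformulas)
  | box φ => {box φ} ∪ φ.subformulas
  | dia φ => {dia φ} ∪ φ.subformulas
  | mu y φ => {mu y φ} ∪ φ.subformulas
  | nu x φ => {nu x φ} ∪ φ.subformulas

/-- `η z. ψ` is a subformula of `φ`; for clean `φ` this says `ψ = ψ_z`. -/
def IsBody (φ : Formula P X Y) (z : X ⊕ Y) (ψ : Formula P X Y) : Prop :=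
  fix z ψ ∈ φ.subformulas

/-- The variables bound by some fixed point operator of `φ`. -/
def boundVars (φ : Formula P X Y) : Set (X ⊕ Y) :=
  {z | ∃ ψ, φ.IsBody z ψ}

/-- No variable is both free and bound, and for every bound variable `z` there is only one
formula `ψ_z` such that `η z. ψ_z` is a subformula. -/
def Clean (φ : Formula P X Y) : Prop :=
  Disjoint φ.freeVars φ.boundVars ∧
    ∀ z ψ ψ', φ.IsBody z ψ → φ.IsBody z ψ' → ψ = ψ'

/-- The dependency order `z₁ ≤_φ z₂` on the bound variables of `φ`:
`z₂` occurs freely in `ψ_{z₁}`. -/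
def Dep (φ : Formula P X Y) (z₁ z₂ : X ⊕ Y) : Prop :=
  z₂ ∈ φ.boundVars ∧ ∃ ψ, φ.IsBody z₁ ψ ∧ z₂ ∈ ψ.freeVars

end Formula

/-! ### Enriched polarities and their complex algebras -/

/-- A polarity `(G, M, I)` with `I`-compatible relations `R_□ ⊆ G × M` and `R_◇ ⊆ M × G`. -/
structure EnrichedPolarity (G M : Type*) where
  I : G → M → Prop
  RBox : G → M → Prop
  RDia : M → G → Prop
  box_lower : ∀ m, IsExtent I (lowerPolar RBox {m})
  box_upper : ∀ g, IsIntent I (upperPolar RBox {g})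
  dia_lower : ∀ g, IsIntent I (lowerPolar RDia {g})
  dia_upper : ∀ m, IsExtent I (upperPolar RDia {m})

namespace EnrichedPolarity

variable {G M : Type*} (F : EnrichedPolarity G M)

/-- The concept lattice of the underlying polarity. -/
abbrev Lat : Type _ := Concept G M F.I

theorem isExtent_box (t : Set M) : IsExtent F.I (lowerPolar F.RBox t) := by
  have h : lowerPolar F.RBox t = ⋂ m ∈ t, lowerPolar F.RBox {m} := by
    ext g
    simp [mem_lowerPolar_iff]
  rw [h]
  exact .iInter₂ _ fun m _ => F.box_lower m

theorem isIntent_dia (s : Set G) : IsIntent F.I (lowerPolar F.RDia s) := by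
  have h : lowerPolar F.RDia s = ⋂ g ∈ s, lowerPolar F.RDia {g} := by
    ext m
    simp [mem_lowerPolar_iff]
  rw [h]
  exact .iInter₂ _ fun g _ => F.dia_lower g

/-- The operation `[R_□]` on concepts: its extent is `R_□^{(0)}` of the intent. -/
def box : F.Lat →o F.Lat where
  toFun c := Concept.ofIsExtent F.I (lowerPolar F.RBox c.intent) (F.isExtent_box _)
  monotone' _ _ h := lowerPolar_anti F.RBox (Concept.intent_subset_intent_iff.2 h)

/-- The operation `⟨R_◇⟩` on concepts: its intent is `R_◇^{(0)}` of the extent. -/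
def dia : F.Lat →o F.Lat where
  toFun c := Concept.ofIsIntent F.I (lowerPolar F.RDia c.extent) (F.isIntent_dia _)
  monotone' _ _ h :=
    Concept.intent_subset_intent_iff.1 (lowerPolar_anti F.RDia (Concept.extent_subset_extent_iff.2 h))

end EnrichedPolarity

/-! ### Semantics -/

section Semantics

variable {G M P X Y : Type*} [DecidableEq X] [DecidableEq Y]

/-- The section `c ↦ f (e[z ↦ c])`, as a monotone map. -/
def sectionHom {L Z : Type*} [DecidableEq Z] [Preorder L] (f : (Z → L) →o L) (z : Z) (e : Z → L) :
    L →o L where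
  toFun c := f (Function.update e z c)
  monotone' _ _ h := f.monotone (update_le_update_iff.2 ⟨h, fun _ _ => le_rfl⟩)

theorem sectionHom_mono {L Z : Type*} [DecidableEq Z] [Preorder L] (f : (Z → L) →o L) (z : Z) :
    Monotone (sectionHom f z) := fun _ _ h _ =>
  f.monotone (update_le_update_iff.2 ⟨le_rfl, fun w _ => h w⟩)

/-- The interpretation of a formula under a valuation `V` of the atoms, as a monotone function of
the assignment of concepts to the variables. -/
def eval (F : EnrichedPolarity G M) (V : P → F.Lat) : Formula P X Y → ((X ⊕ Y → F.Lat) →o F.Lat)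
  | .atom p => ⟨fun _ => V p, fun _ _ _ => le_rfl⟩
  | .var z => ⟨fun e => e z, fun _ _ h => h z⟩
  | .bot => ⟨fun _ => ⊥, fun _ _ _ => le_rfl⟩
  | .top => ⟨fun _ => ⊤, fun _ _ _ => le_rfl⟩
  | .or φ ψ => ⟨fun e => eval F V φ e ⊔ eval F V ψ e,
      fun _ _ h => sup_le_sup ((eval F V φ).monotone h) ((eval F V ψ).monotone h)⟩
  | .and φ ψ => ⟨fun e => eval F V φ e ⊓ eval F V ψ e,
      fun _ _ h => inf_le_inf ((eval F V φ).monotone h) ((eval F V ψ).monotone h)⟩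
  | .box φ => F.box.comp (eval F V φ)
  | .dia φ => F.dia.comp (eval F V φ)
  | .mu y φ => ⟨fun e => OrderHom.lfp (sectionHom (eval F V φ) (.inr y) e),
      fun _ _ h => OrderHom.lfp.monotone (sectionHom_mono _ _ h)⟩
  | .nu x φ => ⟨fun e => OrderHom.gfp (sectionHom (eval F V φ) (.inl x) e),
      fun _ _ h => OrderHom.gfp.monotone (sectionHom_mono _ _ h)⟩

/-- `g ⊩ φ`. -/
def Forces (F : EnrichedPolarity G M) (V : P → F.Lat) (e : X ⊕ Y → F.Lat) (g : G)
    (φ : Formula P X Y) : Prop :=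
  g ∈ (eval F V φ e).extent

/-- `m ≻ φ`. -/
def Refutes (F : EnrichedPolarity G M) (V : P → F.Lat) (e : X ⊕ Y → F.Lat) (m : M)
    (φ : Formula P X Y) : Prop :=
  m ∈ (eval F V φ e).intent

end Semantics

/-! ### Board games -/

/-- The two players: Eloisa (`∃`) and Abelard (`∀`). -/
inductive Player where
  | eloisa
  | abelard

structure BoardGame (B : Type*) where
  /-- The player who has to move. -/
  turn : B → Player
  /-- The admissible moves. -/
  moves : B → Set B
  /-- The infinite plays won by `∃`; all others are won by `∀`. -/
  infWins : Set (ℕ → B)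

namespace BoardGame

variable {B : Type*} (𝒢 : BoardGame B)

/-- `b 0, …, b n` is a play (values of `b` beyond `n` are irrelevant). -/
def IsPlayUpTo (b : ℕ → B) (n : ℕ) : Prop :=
  ∀ i < n, b (i + 1) ∈ 𝒢.moves (b i)

/-- The list `[b 0, …, b n]`. -/
def history (b : ℕ → B) (n : ℕ) : List B :=
  (List.range (n + 1)).map b

/-- `σ` gives an admissible move for `pl` after every partial play that ends in a position of `pl`
with at least one admissible move. -/
def IsStrategy (pl : Player) (σ : List B → B) : Prop :=
  ∀ b n, 𝒢.IsPlayUpTo b n → 𝒢.turn (b n) = pl → (𝒢.moves (b n)).Nonempty →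
    σ (history b n) ∈ 𝒢.moves (b n)

/-- Up to position `b n`, player `pl` has moved according to `σ`. -/
def FollowsUpTo (pl : Player) (σ : List B → B) (b : ℕ → B) (n : ℕ) : Prop :=
  ∀ i < n, 𝒢.turn (b i) = pl → b (i + 1) = σ (history b i)

/-- The infinite play `b` is won by `pl`. -/
def WinsInf : Player → (ℕ → B) → Prop
  | .eloisa, b => b ∈ 𝒢.infWins
  | .abelard, b => b ∉ 𝒢.infWins

/-- `pl` wins every play from `b₀` in which `pl` follows `σ`: if the play ends because a player is
stuck, it is the opponent, and if it is infinite, then it is won by `pl`. -/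
def IsWinning (pl : Player) (σ : List B → B) (b₀ : B) : Prop :=
  (∀ b n, b 0 = b₀ → 𝒢.IsPlayUpTo b n → 𝒢.FollowsUpTo pl σ b n → 𝒢.moves (b n) = ∅ →
    𝒢.turn (b n) ≠ pl) ∧
  (∀ b, b 0 = b₀ → (∀ n, 𝒢.IsPlayUpTo b n) → (∀ n, 𝒢.FollowsUpTo pl σ b n) → 𝒢.WinsInf pl b)

def HasWinningStrategy (pl : Player) (b₀ : B) : Prop :=
  ∃ σ : List B → B, 𝒢.IsStrategy pl σ ∧ 𝒢.IsWinning pl σ b₀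

end BoardGame

/-! ### The evaluation game -/

/-- Positions `(g, φ)` and `(m, φ)`. -/
inductive Position (G M P X Y : Type*) where
  | obj (g : G) (φ : Formula P X Y)
  | feat (m : M) (φ : Formula P X Y)

section Game

variable {G M P X Y : Type*}

def Position.formula : Position G M P X Y → Formula P X Y
  | .obj _ φ => φ
  | .feat _ φ => φ

/-- `∀` moves at positions `(g, φ)` and `∃` at positions `(m, φ)`. The positions that belong to no
player have exactly one admissible move, so it is immaterial to whom they are assigned. -/
def Position.turn : Position G M P X Y → Player
  | .obj _ _ => .abelard
  | .feat _ _ => .eloisa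

/-- `{(m, φ) | g Iᶜ m}` -/
def toFeat (F : EnrichedPolarity G M) (g : G) (φ : Formula P X Y) : Set (Position G M P X Y) :=
  {b | ∃ m, ¬ F.I g m ∧ b = .feat m φ}

/-- `{(g, φ) | g Iᶜ m}` -/
def toObj (F : EnrichedPolarity G M) (m : M) (φ : Formula P X Y) : Set (Position G M P X Y) :=
  {b | ∃ g, ¬ F.I g m ∧ b = .obj g φ}

/-- The admissible moves of the game for the formula `φ₀`. A variable that is bound in `φ₀` is
unfolded; a variable that is not bound in `φ₀` is treated as an atom with value `e z`. -/
def evalMoves (F : EnrichedPolarity G M) (V : P → F.Lat) (e : X ⊕ Y → F.Lat)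
    (φ₀ : Formula P X Y) : Position G M P X Y → Set (Position G M P X Y)
  | .obj g (.atom p) => {b | g ∉ (V p).extent ∧ b ∈ toFeat F g (.atom p)}
  | .feat m (.atom p) => {b | m ∉ (V p).intent ∧ b ∈ toObj F m (.atom p)}
  | .obj _ .top => ∅
  | .feat m .top => toObj F m .top
  | .obj g .bot => toFeat F g .bot
  | .feat _ .bot => ∅
  | .obj g (.or φ ψ) => toFeat F g (.or φ ψ)
  | .feat m (.or φ ψ) => {.feat m φ, .feat m ψ}
  | .obj g (.and φ ψ) => {.obj g φ, .obj g ψ}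
  | .feat m (.and φ ψ) => toObj F m (.and φ ψ)
  | .obj g (.dia φ) => toFeat F g (.dia φ)
  | .feat m (.dia φ) => {b | ∃ g, ¬ F.RDia m g ∧ b = .obj g φ}
  | .obj g (.box φ) => {b | ∃ m, ¬ F.RBox g m ∧ b = .feat m φ}
  | .feat m (.box φ) => toObj F m (.box φ)
  | .obj g (.nu _ φ) => {.obj g φ}
  | .feat m (.nu x φ) => toObj F m (.nu x φ)
  | .obj g (.mu y φ) => toFeat F g (.mu y φ)
  | .feat m (.mu _ φ) => {.feat m φ}
  | .obj g (.var (.inl x)) =>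
      {b | (∃ ψ, φ₀.IsBody (.inl x) ψ ∧ b = .obj g (.nu x ψ)) ∨
        (.inl x ∉ φ₀.boundVars ∧ g ∉ (e (.inl x)).extent ∧ b ∈ toFeat F g (.var (.inl x)))}
  | .feat m (.var (.inl x)) =>
      {b | (.inl x ∈ φ₀.boundVars ∨ m ∉ (e (.inl x)).intent) ∧ b ∈ toObj F m (.var (.inl x))}
  | .obj g (.var (.inr y)) =>
      {b | (.inr y ∈ φ₀.boundVars ∨ g ∉ (e (.inr y)).extent) ∧ b ∈ toFeat F g (.var (.inr y))}
  | .feat m (.var (.inr y)) =>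
      {b | (∃ ψ, φ₀.IsBody (.inr y) ψ ∧ b = .feat m (.mu y ψ)) ∨
        (.inr y ∉ φ₀.boundVars ∧ m ∉ (e (.inr y)).intent ∧ b ∈ toObj F m (.var (.inr y)))}

/-- The bound variables of `φ₀` that are repeated infinitely often in `b`. -/
def infVars (φ₀ : Formula P X Y) (b : ℕ → Position G M P X Y) : Set (X ⊕ Y) :=
  {z | z ∈ φ₀.boundVars ∧ ∃ᶠ n in Filter.atTop, (b n).formula = .var z}

/-- The evaluation game for the formula `φ₀`. An infinite play is won by `∃` if a maximal bound
variable, in the dependency order, among those repeated infinitely often is a `ν`-variable;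
all other infinite plays, also those in which no bound variable is repeated infinitely often,
are won by `∀`. -/
def evalGame (F : EnrichedPolarity G M) (V : P → F.Lat) (e : X ⊕ Y → F.Lat)
    (φ₀ : Formula P X Y) : BoardGame (Position G M P X Y) where
  turn := Position.turn
  moves := evalMoves F V e φ₀
  infWins := {b | ∃ x : X, .inl x ∈ infVars φ₀ b ∧
    ∀ z ∈ infVars φ₀ b, φ₀.Dep (.inl x) z → z = .inl x}

end Game

end NDMu

namespace NDMu

/-! ### Strategies from simulations -/

namespace BoardGame

variable {B : Type*} (𝒢 : BoardGame B)

/-! The player `pl` who is right about the truth value of `φ` at a position has a winning strategy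
from it: `∃` if the value is "true", `∀` if it is "false". The two players cannot both have one, so
both directions follow and no determinacy theorem is needed.

The strategy keeps `pl` right along the play. Since every concept is determined by its extent as
well as by its intent, truth at `(g, ψ)` is truth after all moves of `∀`, and truth at `(m, ψ)` is
truth after some move of `∃` (`Position.Plain.holds_iff_of_abelard`,
`Position.Plain.holds_iff_of_eloisa`).

Infinite plays are handled by ordinal signatures. For the variables that `pl` has to unfold (`μ` for
`∃`, `ν` for `∀`) the play is annotated with approximations of the fixed point instead of the fixed
point itself; entering a fixed point formula picks the least ordinal that works. Suppose such a `z`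
is maximal among the variables repeated infinitely often. The play then eventually stays below the
binder of `z` and returns to it only from the variable `z`, so each return lowers the ordinal
(`Position.Sat.exists_lt`), which is absurd (`unfolder_ne_of_maximal`). Unfolding happens at
positions where this works: extents turn infima, and intents turn suprema, into intersections, so
failing to lie in one singles out one earlier stage.

For `∃` it must also be shown that some bound variable recurs. Otherwise the formula is eventually
constant, which cannot happen for two moves from a true position `(g, ψ)`. -/

theorem history_succ (b : ℕ → B) (n : ℕ) : history b (n + 1) = history b n ++ [b (n + 1)] := by
  simp [history, List.range_succ]

theorem getLastD_history (b : ℕ → B) (n : ℕ) (d : B) : (history b n).getLastD d = b n := by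
  cases n with
  | zero => rfl
  | succ n => simp [history_succ]

theorem history_ne_nil (b : ℕ → B) (n : ℕ) : history b n ≠ [] := by
  simp [history]

theorem tail_history_succ (b : ℕ → B) (n : ℕ) :
    (history b (n + 1)).tail = (history b n).tail ++ [b (n + 1)] := by
  rw [history_succ, List.tail_append_of_ne_nil (history_ne_nil b n)]

/-- A player who can keep up a simulation of the play by a sequence of states, all of whose infinite
runs are won by that player, has a winning strategy. -/
theorem hasWinningStrategy_of_simulation {S : Type*} {pl : Player} (pos : S → B) (Inv : S → Prop)
    (Step : S → S → Prop)
    (hmove : ∀ s s', Step s s' → pos s' ∈ 𝒢.moves (pos s))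
    (hinv : ∀ s s', Step s s' → Inv s')
    (hown : ∀ s, Inv s → 𝒢.turn (pos s) = pl → ∃ s', Step s s')
    (hopp : ∀ s, Inv s → 𝒢.turn (pos s) ≠ pl → ∀ b ∈ 𝒢.moves (pos s), ∃ s', Step s s' ∧ pos s' = b)
    (hinf : ∀ s : ℕ → S, Inv (s 0) → (∀ n, Step (s n) (s (n + 1))) →
      𝒢.WinsInf pl fun n => pos (s n))
    (s₀ : S) (h₀ : Inv s₀) : 𝒢.HasWinningStrategy pl (pos s₀) := by
  classical
  -- The state chosen here may differ from the one that suggested the move; only its position has to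
  -- agree.
  let next : S → B → S := fun s b =>
    if h : ∃ s', Step s s' ∧ pos s' = b then h.choose else s
  -- The head of the history is already represented by `s₀`, hence the tail.
  let track : List B → S := fun l => l.tail.foldl next s₀
  -- `IsStrategy` constrains `σ` after all partial plays, also those that have left the simulation;
  -- there any admissible move will do. Histories are nonempty, so the default of `getLastD` is
  -- never used.
  let σ : List B → B := fun l =>
    if h : pos (track l) = l.getLastD (pos s₀) ∧ ∃ s', Step (track l) s' then pos h.2.choose
    else if h : (𝒢.moves (l.getLastD (pos s₀))).Nonempty then h.choose else pos s₀
  have next_spec : ∀ s b, (∃ s', Step s s' ∧ pos s' = b) → Step s (next s b) ∧ pos (next s b) = b := by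
    intro s b h
    simp only [next, dif_pos h]
    exact h.choose_spec
  have track_succ : ∀ b n, track (history b (n + 1)) = next (track (history b n)) (b (n + 1)) := by
    intro b n
    simp only [track, tail_history_succ, List.foldl_append, List.foldl_cons, List.foldl_nil]
  have σ_spec : ∀ b n, pos (track (history b n)) = b n → (∃ s', Step (track (history b n)) s') →
      ∃ s', Step (track (history b n)) s' ∧ pos s' = σ (history b n) := by
    intro b n hp h
    have hc : pos (track (history b n)) = (history b n).getLastD (pos s₀) ∧
        ∃ s', Step (track (history b n)) s' := ⟨by rw [getLastD_history, hp], h⟩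
    simp only [σ, dif_pos hc]
    exact ⟨_, hc.2.choose_spec, rfl⟩
  have key : ∀ b, b 0 = pos s₀ → ∀ n, 𝒢.IsPlayUpTo b n → 𝒢.FollowsUpTo pl σ b n →
      Inv (track (history b n)) ∧ pos (track (history b n)) = b n ∧
        ∀ i < n, Step (track (history b i)) (track (history b (i + 1))) := by
    intro b hb n
    induction n with
    | zero => exact fun _ _ => ⟨h₀, hb.symm, fun i hi => absurd hi (Nat.not_lt_zero i)⟩
    | succ n ih =>
      intro hp hf
      obtain ⟨hI, hpos, hs⟩ := ih (fun i hi => hp i (hi.trans n.lt_succ_self))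
        fun i hi => hf i (hi.trans n.lt_succ_self)
      have hmv := hp n n.lt_succ_self
      have : ∃ s', Step (track (history b n)) s' ∧ pos s' = b (n + 1) := by
        by_cases ht : 𝒢.turn (b n) = pl
        · rw [hf n n.lt_succ_self ht]
          exact σ_spec b n hpos (hown _ hI (by rwa [hpos]))
        · exact hopp _ hI (by rwa [hpos]) _ (by rwa [hpos])
      have h2 := next_spec _ _ this
      rw [← track_succ] at h2
      refine ⟨hinv _ _ h2.1, h2.2, fun i hi => ?_⟩
      rcases Nat.lt_succ_iff_lt_or_eq.1 hi with h | rfl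
      · exact hs i h
      · exact h2.1
  refine ⟨σ, fun b n _ _ hne => ?_, fun b n hb hp hf he ht => ?_, fun b hb hp hf => ?_⟩
  · by_cases hc : pos (track (history b n)) = (history b n).getLastD (pos s₀) ∧
        ∃ s', Step (track (history b n)) s'
    · simp only [σ, dif_pos hc]
      have he : 𝒢.moves (pos (track (history b n))) = 𝒢.moves (b n) := by
        rw [hc.1, getLastD_history]
      exact he.subset (hmove _ _ hc.2.choose_spec)
    · have hne' : (𝒢.moves ((history b n).getLastD (pos s₀))).Nonempty := by
        rwa [getLastD_history]
      simp only [σ, dif_neg hc, dif_pos hne']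
      exact (congrArg 𝒢.moves (getLastD_history b n _)).subset hne'.choose_spec
  · obtain ⟨hI, hpos, -⟩ := key b hb n hp hf
    obtain ⟨s', hs'⟩ := hown _ hI (by rwa [hpos])
    have := hmove _ _ hs'
    rw [hpos, he] at this
    exact this
  · have hk := fun n => key b hb n (hp n) (hf n)
    have := hinf (fun n => track (history b n)) h₀ fun n => (hk (n + 1)).2.2 n n.lt_succ_self
    rwa [show (fun n => pos (track (history b n))) = b from funext fun n => (hk n).2.1] at this

/-- The players cannot both have a winning strategy from the same position. -/
theorem not_hasWinningStrategy_both (b₀ : B) (h₁ : 𝒢.HasWinningStrategy .eloisa b₀)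
    (h₂ : 𝒢.HasWinningStrategy .abelard b₀) : False := by
  classical
  obtain ⟨σ, hσ, hσ₁, hσ₂⟩ := h₁
  obtain ⟨τ, hτ, hτ₁, hτ₂⟩ := h₂
  -- The two strategies are played against each other; `b` below is the resulting play.
  let reply : List B → B := fun l =>
    match 𝒢.turn (l.getLastD b₀) with
    | .eloisa => σ l
    | .abelard => τ l
  let H : ℕ → List B := fun n => Nat.rec [b₀] (fun _ l => l ++ [reply l]) n
  let b : ℕ → B := fun n => (H n).getLastD b₀
  have hb0 : b 0 = b₀ := rfl
  have hH : ∀ n, history b n = H n := by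
    intro n
    induction n with
    | zero => rfl
    | succ n ih =>
      rw [history_succ, ih]
      simp [b, H]
  have hb : ∀ n, b (n + 1) = reply (history b n) := by
    intro n
    rw [hH]
    simp [b, H]
  have hfe : ∀ n, 𝒢.FollowsUpTo .eloisa σ b n := by
    intro n i _ ht
    rw [hb]
    simp only [reply, getLastD_history, ht]
  have hfa : ∀ n, 𝒢.FollowsUpTo .abelard τ b n := by
    intro n i _ ht
    rw [hb]
    simp only [reply, getLastD_history, ht]
  have hplay : ∀ n, (∀ i < n, (𝒢.moves (b i)).Nonempty) → 𝒢.IsPlayUpTo b n := by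
    intro n
    induction n with
    | zero => exact fun _ i hi => absurd hi (Nat.not_lt_zero i)
    | succ n ih =>
      intro hne
      have hp := ih fun i hi => hne i (hi.trans n.lt_succ_self)
      intro i hi
      rcases Nat.lt_succ_iff_lt_or_eq.1 hi with h | rfl
      · exact hp i h
      · cases ht : 𝒢.turn (b i) with
        | eloisa =>
          rw [hfe (i + 1) i i.lt_succ_self ht]
          exact hσ b i hp ht (hne i i.lt_succ_self)
        | abelard =>
          rw [hfa (i + 1) i i.lt_succ_self ht]
          exact hτ b i hp ht (hne i i.lt_succ_self)
  by_cases hall : ∀ n, (𝒢.moves (b n)).Nonempty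
  · exact hτ₂ b hb0 (fun n => hplay n fun i _ => hall i) hfa
      (hσ₂ b hb0 (fun n => hplay n fun i _ => hall i) hfe)
  · push Not at hall
    have hp := hplay (Nat.find hall) fun i hi => Set.nonempty_iff_ne_empty.2 (Nat.find_min hall hi)
    have he := Nat.find_spec hall
    have h1 := hσ₁ b _ hb0 hp (hfe _) he
    have h2 := hτ₁ b _ hb0 hp (hfa _) he
    cases ht : 𝒢.turn (b (Nat.find hall)) with
    | eloisa => exact h1 ht
    | abelard => exact h2 ht

end BoardGame

/-! ### Subformulas and scopes -/

namespace Formula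

variable {P X Y : Type*}

/-- The number of symbols of a formula. -/
def size : Formula P X Y → ℕ
  | atom _ => 1
  | var _ => 1
  | bot => 1
  | top => 1
  | or φ ψ => φ.size + ψ.size + 1
  | and φ ψ => φ.size + ψ.size + 1
  | box φ => φ.size + 1
  | dia φ => φ.size + 1
  | mu _ φ => φ.size + 1
  | nu _ φ => φ.size + 1

theorem size_fix (z : X ⊕ Y) (φ : Formula P X Y) : (fix z φ).size = φ.size + 1 := by
  cases z <;> rfl

theorem freeVars_fix (z : X ⊕ Y) (φ : Formula P X Y) : (fix z φ).freeVars = φ.freeVars \ {z} := by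
  cases z <;> rfl

theorem subformulas_fix (z : X ⊕ Y) (φ : Formula P X Y) :
    (fix z φ).subformulas = {fix z φ} ∪ φ.subformulas := by
  cases z <;> rfl

theorem fix_inj {z w : X ⊕ Y} {φ ψ : Formula P X Y} : fix z φ = fix w ψ ↔ z = w ∧ φ = ψ := by
  cases z <;> cases w <;> simp [fix]

theorem mem_subformulas_self (φ : Formula P X Y) : φ ∈ φ.subformulas := by
  cases φ <;> simp [subformulas]

theorem subformulas_subset {φ ψ : Formula P X Y} (h : ψ ∈ φ.subformulas) :
    ψ.subformulas ⊆ φ.subformulas := by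
  induction φ with
  | atom | var | bot | top =>
    rw [subformulas, Set.mem_singleton_iff] at h
    rw [h]
  | or φ₁ φ₂ ih₁ ih₂ | and φ₁ φ₂ ih₁ ih₂ =>
    rcases h with h | h | h
    · rw [Set.mem_singleton_iff.1 h]
    · exact fun χ hχ => Or.inr (Or.inl (ih₁ h hχ))
    · exact fun χ hχ => Or.inr (Or.inr (ih₂ h hχ))
  | box φ ih | dia φ ih | mu _ φ ih | nu _ φ ih =>
    rcases h with h | h
    · rw [Set.mem_singleton_iff.1 h]
    · exact fun χ hχ => Or.inr (ih h hχ)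

theorem body_mem_subformulas {φ ψ : Formula P X Y} {z : X ⊕ Y} (h : φ.IsBody z ψ) :
    ψ ∈ φ.subformulas :=
  subformulas_subset h (subformulas_fix z ψ ▸ Or.inr (mem_subformulas_self ψ))

theorem eq_or_size_lt_of_mem_subformulas {φ ψ : Formula P X Y} (h : ψ ∈ φ.subformulas) :
    ψ = φ ∨ ψ.size < φ.size := by
  induction φ with
  | atom | var | bot | top => exact Or.inl h
  | or φ₁ φ₂ ih₁ ih₂ | and φ₁ φ₂ ih₁ ih₂ =>
    rcases h with h | h | h
    · exact Or.inl h
    · right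
      have : ψ.size ≤ φ₁.size := (ih₁ h).elim (fun h => h ▸ le_rfl) le_of_lt
      simp only [size]
      omega
    · right
      have : ψ.size ≤ φ₂.size := (ih₂ h).elim (fun h => h ▸ le_rfl) le_of_lt
      simp only [size]
      omega
  | box φ ih | dia φ ih | mu _ φ ih | nu _ φ ih =>
    rcases h with h | h
    · exact Or.inl h
    · right
      have : ψ.size ≤ φ.size := (ih h).elim (fun h => h ▸ le_rfl) le_of_lt
      simp only [size]
      omega

theorem size_le_of_mem_subformulas {φ ψ : Formula P X Y} (h : ψ ∈ φ.subformulas) :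
    ψ.size ≤ φ.size :=
  (eq_or_size_lt_of_mem_subformulas h).elim (fun h => h ▸ le_rfl) le_of_lt

theorem finite_subformulas (φ : Formula P X Y) : φ.subformulas.Finite := by
  induction φ with
  | atom | var | bot | top => exact Set.finite_singleton _
  | or φ₁ φ₂ ih₁ ih₂ | and φ₁ φ₂ ih₁ ih₂ => exact (Set.finite_singleton _).union (ih₁.union ih₂)
  | box φ ih | dia φ ih | mu _ φ ih | nu _ φ ih => exact (Set.finite_singleton _).union ih

theorem finite_setOf_var_mem_subformulas (φ : Formula P X Y) :
    {z : X ⊕ Y | var z ∈ φ.subformulas}.Finite :=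
  (finite_subformulas φ).preimage fun _ _ _ _ h => var.inj h

/-- A free variable of a subformula `ψ` of `φ` is free in `φ` or bound by an operator of `φ` with
`ψ` in its scope. -/
theorem mem_freeVars_or_exists_scope {φ ψ : Formula P X Y} {z : X ⊕ Y} (h : ψ ∈ φ.subformulas)
    (hz : z ∈ ψ.freeVars) :
    z ∈ φ.freeVars ∨ ∃ χ, φ.IsBody z χ ∧ ψ ∈ χ.subformulas := by
  -- The cases `mu` and `nu` are the same argument for `fix w χ`, where the new binder captures `z`
  -- exactly if `w = z`.
  have fix_case : ∀ (w : X ⊕ Y) (χ : Formula P X Y), (ψ ∈ χ.subformulas →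
      z ∈ χ.freeVars ∨ ∃ θ, χ.IsBody z θ ∧ ψ ∈ θ.subformulas) → ψ ∈ (fix w χ).subformulas →
      z ∈ (fix w χ).freeVars ∨ ∃ θ, (fix w χ).IsBody z θ ∧ ψ ∈ θ.subformulas := by
    intro w χ ih h
    rw [subformulas_fix] at h
    rcases h with h | h
    · exact Or.inl (Set.mem_singleton_iff.1 h ▸ hz)
    · rcases ih h with h' | ⟨θ, h₁, h₂⟩
      · by_cases hzw : z = w
        · subst hzw
          exact Or.inr ⟨χ, mem_subformulas_self _, h⟩
        · exact Or.inl (freeVars_fix w χ ▸ ⟨h', hzw⟩)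
      · exact Or.inr ⟨θ, (subformulas_fix w χ).superset (Or.inr h₁), h₂⟩
  induction φ with
  | atom | var | bot | top => exact Or.inl (Set.mem_singleton_iff.1 h ▸ hz)
  | or φ₁ φ₂ ih₁ ih₂ | and φ₁ φ₂ ih₁ ih₂ =>
    rcases h with h | h | h
    · exact Or.inl (Set.mem_singleton_iff.1 h ▸ hz)
    · rcases ih₁ h with h | ⟨χ, h₁, h₂⟩
      · exact Or.inl (Or.inl h)
      · exact Or.inr ⟨χ, Or.inr (Or.inl h₁), h₂⟩
    · rcases ih₂ h with h | ⟨χ, h₁, h₂⟩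
      · exact Or.inl (Or.inr h)
      · exact Or.inr ⟨χ, Or.inr (Or.inr h₁), h₂⟩
  | box φ ih | dia φ ih =>
    rcases h with h | h
    · exact Or.inl (Set.mem_singleton_iff.1 h ▸ hz)
    · rcases ih h with h | ⟨χ, h₁, h₂⟩
      · exact Or.inl h
      · exact Or.inr ⟨χ, Or.inr h₁, h₂⟩
  | mu y φ ih => exact fix_case (.inr y) φ ih h
  | nu x φ ih => exact fix_case (.inl x) φ ih h

variable {φ : Formula P X Y}

/-- In a clean formula every subformula with a free occurrence of a bound variable `z` lies in the
scope of the operator that binds `z`. -/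
theorem Clean.mem_subformulas_body (hφ : φ.Clean) {ψ χ : Formula P X Y} {z : X ⊕ Y}
    (hψ : ψ ∈ φ.subformulas) (hz : z ∈ ψ.freeVars) (hχ : φ.IsBody z χ) : ψ ∈ χ.subformulas := by
  rcases mem_freeVars_or_exists_scope hψ hz with h | ⟨θ, h₁, h₂⟩
  · exact absurd ⟨χ, hχ⟩ (Set.disjoint_left.1 hφ.1 h)
  · rwa [hφ.2 z χ θ hχ h₁]

/-- As `w` is free in `fix z χ`, this whole formula lies in the scope of `w`, that is, inside `θ`.
So bodies grow strictly along dependencies between distinct variables. -/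
theorem Clean.size_body_lt (hφ : φ.Clean) {z w : X ⊕ Y} {χ θ : Formula P X Y}
    (hχ : φ.IsBody z χ) (hθ : φ.IsBody w θ) (hw : w ∈ χ.freeVars) (hne : w ≠ z) :
    χ.size < θ.size := by
  have h := size_le_of_mem_subformulas <|
    hφ.mem_subformulas_body hχ (freeVars_fix z χ ▸ ⟨hw, hne⟩ : w ∈ (fix z χ).freeVars) hθ
  rw [size_fix] at h
  exact h

/-- The bound variables of `φ` on which the meaning of `ψ` depends, directly or through the bodies
of other such variables. -/
inductive Active (φ ψ : Formula P X Y) : X ⊕ Y → Prop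
  | free {z} : z ∈ ψ.freeVars → z ∈ φ.boundVars → Active φ ψ z
  | dep {z w} : Active φ ψ z → φ.Dep z w → Active φ ψ w

theorem Active.mono {ψ ψ' : Formula P X Y} (hs : ψ.freeVars ⊆ ψ'.freeVars) {z : X ⊕ Y}
    (h : φ.Active ψ z) : φ.Active ψ' z := by
  induction h with
  | free h₁ h₂ => exact .free (hs h₁) h₂
  | dep _ hd ih => exact .dep ih hd

theorem Clean.not_active_self (hφ : φ.Clean) {z : X ⊕ Y} : ¬ φ.Active φ z := by
  intro h
  induction h with
  | free h₁ h₂ => exact Set.disjoint_left.1 hφ.1 h₁ h₂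
  | dep _ _ ih => exact ih

/-- Passing to the body frees at most `z`, and whatever `z` depends on is already active in the
fixed point formula. -/
theorem Clean.active_body (hφ : φ.Clean) {z w : X ⊕ Y} {χ : Formula P X Y} (hχ : φ.IsBody z χ)
    (h : φ.Active χ w) : w = z ∨ φ.Active (fix z χ) w := by
  have aux : ∀ u, u ∈ χ.freeVars → u ∈ φ.boundVars → u = z ∨ φ.Active (fix z χ) u := by
    intro u hu hb
    by_cases huz : u = z
    · exact Or.inl huz
    · exact Or.inr (.free (freeVars_fix z χ ▸ ⟨hu, huz⟩) hb)
  induction h with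
  | free h₁ h₂ => exact aux _ h₁ h₂
  | dep _ hd ih =>
    rcases ih with rfl | ih
    · obtain ⟨hb, θ, hθ, hf⟩ := hd
      rw [hφ.2 _ θ χ hθ hχ] at hf
      exact aux _ hf hb
    · exact Or.inr (.dep ih hd)

theorem Active.var_of_fix {z w : X ⊕ Y} {χ : Formula P X Y} (hχ : φ.IsBody z χ)
    (h : φ.Active (fix z χ) w) : φ.Active (var z) w := by
  induction h with
  | free h₁ h₂ =>
    rw [freeVars_fix] at h₁
    exact .dep (.free (Set.mem_singleton z) ⟨χ, hχ⟩) ⟨h₂, χ, hχ, h₁.1⟩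
  | dep _ hd ih => exact .dep ih hd

/-- Bodies grow along dependency chains. In particular no chain from `fix z χ` returns to `z`, so
the value of `z` may be reset on entering `χ` without disturbing the variables active outside. -/
theorem Clean.size_lt_of_active (hφ : φ.Clean) {z w : X ⊕ Y} {χ θ : Formula P X Y}
    (hχ : φ.IsBody z χ) (h : φ.Active (fix z χ) w) (hθ : φ.IsBody w θ) : χ.size < θ.size := by
  induction h generalizing θ with
  | free h₁ _ =>
    rw [freeVars_fix] at h₁
    exact hφ.size_body_lt hχ hθ h₁.1 h₁.2
  | @dep u w _ hd ih =>
    obtain ⟨-, ξ, hξ, hf⟩ := hd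
    by_cases hwu : w = u
    · subst hwu
      exact ih hθ
    · exact (ih hξ).trans (hφ.size_body_lt hξ hθ hf hwu)

theorem Clean.not_active_fix_self (hφ : φ.Clean) {z : X ⊕ Y} {χ : Formula P X Y}
    (hχ : φ.IsBody z χ) : ¬ φ.Active (fix z χ) z :=
  fun h => lt_irrefl _ (hφ.size_lt_of_active hχ h hχ)

/-! ### Sequences of formulas traced out by plays -/

/-- `f` passes from a formula to one of its subformulas, or from a bound variable to the formula
that binds it. -/
def IsTrace (φ : Formula P X Y) (f : ℕ → Formula P X Y) : Prop :=
  f 0 ∈ φ.subformulas ∧ ∀ n, f (n + 1) ∈ (f n).subformulas ∨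
    ∃ z χ, φ.IsBody z χ ∧ f n = var z ∧ f (n + 1) = fix z χ

/-- The bound variables that occur infinitely often in `f`. -/
def infOften (φ : Formula P X Y) (f : ℕ → Formula P X Y) : Set (X ⊕ Y) :=
  {z | z ∈ φ.boundVars ∧ ∃ᶠ n in Filter.atTop, f n = var z}

variable {f : ℕ → Formula P X Y}

theorem IsTrace.mem_subformulas (hf : φ.IsTrace f) (n : ℕ) : f n ∈ φ.subformulas := by
  induction n with
  | zero => exact hf.1
  | succ n ih =>
    rcases hf.2 n with h | ⟨z, χ, hχ, -, h⟩
    · exact subformulas_subset ih h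
    · exact h ▸ hχ

/-- Only finitely many variables occur in `φ`, so a single bound lies beyond the last visits to all
those visited finitely often. -/
theorem IsTrace.eventually_mem_infOften (hf : φ.IsTrace f) :
    ∀ᶠ n in Filter.atTop, ∀ z ∈ φ.boundVars, f n = var z → z ∈ φ.infOften f := by
  have h : ∀ᶠ n in Filter.atTop, ∀ z ∈ {z : X ⊕ Y | var z ∈ φ.subformulas},
      z ∈ φ.boundVars → f n = var z → z ∈ φ.infOften f := by
    rw [Filter.eventually_all_finite (finite_setOf_var_mem_subformulas φ)]
    intro z _
    by_cases hz : z ∈ φ.infOften f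
    · exact Filter.Eventually.of_forall fun _ _ _ => hz
    · by_cases hb : z ∈ φ.boundVars
      · have : ¬ ∃ᶠ n in Filter.atTop, f n = var z := fun h => hz ⟨hb, h⟩
        rw [Filter.not_frequently] at this
        filter_upwards [this] with n hn _ h
        exact absurd h hn
      · exact Filter.Eventually.of_forall fun _ h => absurd h hb
  filter_upwards [h] with n hn z hb hz
  exact hn z (hz ▸ hf.mem_subformulas n) hb hz

/-- A trace eventually stays below the binder of a maximal variable that it visits infinitely
often. -/
theorem IsTrace.eventually_mem_subformulas_fix (hφ : φ.Clean) (hf : φ.IsTrace f) {z : X ⊕ Y}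
    {χ : Formula P X Y} (hχ : φ.IsBody z χ) (hz : z ∈ φ.infOften f)
    (hmax : ∀ w ∈ φ.infOften f, φ.Dep z w → w = z) :
    ∀ᶠ n in Filter.atTop, f n ∈ (fix z χ).subformulas := by
  obtain ⟨N, hN⟩ := Filter.eventually_atTop.1 hf.eventually_mem_infOften
  obtain ⟨k, hk, hkz⟩ := Filter.frequently_atTop.1 hz.2 N
  refine Filter.eventually_atTop.2 ⟨k, fun n hn => ?_⟩
  induction n, hn using Nat.le_induction with
  | base =>
    rw [subformulas_fix]
    exact Or.inr (hφ.mem_subformulas_body (hf.mem_subformulas k)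
      (by rw [hkz]; exact Set.mem_singleton z) hχ)
  | succ n hn ih =>
    rcases hf.2 n with h | ⟨w, θ, hθ, hw, h⟩
    · exact subformulas_subset ih h
    · have hwS := hN n (hk.trans hn) w ⟨θ, hθ⟩ hw
      -- If `w` were free in `fix z χ`, then `z` would depend on `w` and maximality would force `w =
      -- z`, which is not free there. So the binder of `w` lies below that of `z`.
      rcases mem_freeVars_or_exists_scope (z := w) ih (by rw [hw]; exact Set.mem_singleton w) with
        h' | ⟨ξ, hξ, -⟩
      · rw [freeVars_fix] at h'
        exact absurd (hmax w hwS ⟨⟨θ, hθ⟩, χ, hχ, h'.1⟩) h'.2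
      · rw [h, hφ.2 w θ ξ hθ (subformulas_subset hχ hξ)]
        exact hξ

/-- Without a maximal element one could climb along dependencies forever, meeting ever larger
bodies, yet all of them are subformulas of `φ`. -/
theorem Clean.exists_maximal (hφ : φ.Clean) {S : Set (X ⊕ Y)} (hS : S ⊆ φ.boundVars)
    (hne : S.Nonempty) : ∃ z ∈ S, ∀ w ∈ S, φ.Dep z w → w = z := by
  by_contra! hcon
  have : ∀ k : ℕ, ∃ z ∈ S, ∃ χ, φ.IsBody z χ ∧ k ≤ χ.size := by
    intro k
    induction k with
    | zero =>
      obtain ⟨z, hz⟩ := hne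
      obtain ⟨χ, hχ⟩ := hS hz
      exact ⟨z, hz, χ, hχ, Nat.zero_le _⟩
    | succ k ih =>
      obtain ⟨z, hz, χ, hχ, hk⟩ := ih
      obtain ⟨w, hw, ⟨-, χ', hχ', hf⟩, hne⟩ := hcon z hz
      obtain ⟨θ, hθ⟩ := hS hw
      rw [hφ.2 z χ' χ hχ' hχ] at hf
      exact ⟨w, hw, θ, hθ, hk.trans_lt (hφ.size_body_lt hχ hθ hf hne)⟩
  obtain ⟨z, -, χ, hχ, h⟩ := this (φ.size + 1)
  exact absurd (size_le_of_mem_subformulas (body_mem_subformulas hχ)) (by omega)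

/-- A trace that visits no bound variable infinitely often is eventually constant. -/
theorem IsTrace.eventually_const (hf : φ.IsTrace f) (h : φ.infOften f = ∅) :
    ∃ N, ∀ n ≥ N, f (n + 1) = f n := by
  obtain ⟨N, hN⟩ := Filter.eventually_atTop.1 hf.eventually_mem_infOften
  have hsub : ∀ n ≥ N, f (n + 1) ∈ (f n).subformulas := by
    intro n hn
    rcases hf.2 n with h' | ⟨z, χ, hχ, hz, -⟩
    · exact h'
    · have := hN n hn z ⟨χ, hχ⟩ hz
      rw [h] at this
      exact this.elim
  -- Past `N` the formula only shrinks, so it is constant from where its size is least.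
  obtain ⟨k, hk⟩ := WellFounded.has_min (measure fun n => (f n).size).wf (Set.Ici N)
    ⟨N, Set.self_mem_Ici⟩
  have hle : ∀ n ≥ k, (f n).size = (f k).size := by
    intro n hn
    refine le_antisymm ?_ (not_lt.1 (hk.2 n (le_trans hk.1 hn)))
    induction n, hn using Nat.le_induction with
    | base => exact le_rfl
    | succ n hn ih =>
      exact (size_le_of_mem_subformulas (hsub n (le_trans hk.1 hn))).trans ih
  refine ⟨k, fun n hn => ?_⟩
  rcases eq_or_size_lt_of_mem_subformulas (hsub n (le_trans hk.1 hn)) with h' | h'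
  · exact h'
  · rw [hle n hn, hle (n + 1) (hn.trans n.le_succ)] at h'
    exact absurd h' (lt_irrefl _)

end Formula

open Order OrdinalApprox

universe u v

/-! ### Truth of values at positions -/

/-- The player who moves at the positions where the variable `z` is unfolded. -/
def unfolder {X Y : Type*} : X ⊕ Y → Player
  | .inl _ => .abelard
  | .inr _ => .eloisa

section Values

variable {X Y : Type*} {L : Type u} [CompleteLattice L]

/-- The extremal fixed point that belongs to the kind of the variable `z`. -/
def fixedPoint : X ⊕ Y → (L →o L) → L
  | .inl _, f => f.gfp
  | .inr _, f => f.lfp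

/-- The value that player `pl` works with for the variable `z`: an ordinal approximation if `pl`
loses by unfolding `z` forever, and the fixed point itself otherwise. -/
def value : Player → X ⊕ Y → (L →o L) → Ordinal.{u} → L
  | .eloisa, .inl _, f, _ => f.gfp
  | .eloisa, .inr _, f, a => lfpApprox f ⊥ a
  | .abelard, .inl _, f, a => gfpApprox f ⊤ a
  | .abelard, .inr _, f, _ => f.lfp

theorem map_fixedPoint (z : X ⊕ Y) (f : L →o L) : f (fixedPoint z f) = fixedPoint z f := by
  cases z
  · exact f.map_gfp
  · exact f.map_lfp

theorem value_of_unfolder_ne {pl : Player} {z : X ⊕ Y} (h : unfolder z ≠ pl) (f : L →o L)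
    (a : Ordinal.{u}) : value pl z f a = fixedPoint z f := by
  cases pl <;> cases z <;> first | rfl | exact absurd rfl h

/-- The approximations reach the fixed point at an ordinal in the universe of the lattice. -/
theorem exists_value_eq_fixedPoint (pl : Player) (z : X ⊕ Y) (f : L →o L) :
    ∃ a, value pl z f a = fixedPoint z f := by
  cases pl <;> cases z
  · exact ⟨0, rfl⟩
  · exact ⟨_, lfpApprox_ord_eq_lfp f⟩
  · exact ⟨_, gfpApprox_ord_eq_gfp f⟩
  · exact ⟨0, rfl⟩

end Values

section Truth

variable {G : Type u} {M : Type v} {P X Y : Type*} {F : EnrichedPolarity G M}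

theorem mem_extent_iff (c : F.Lat) (g : G) :
    g ∈ c.extent ↔ ∀ m, ¬ F.I g m → m ∉ c.intent := by
  rw [← c.lowerPolar_intent, mem_lowerPolar_iff]
  exact forall_congr' fun m => not_imp_not.symm

theorem notMem_intent_iff (c : F.Lat) (m : M) :
    m ∉ c.intent ↔ ∃ g, ¬ F.I g m ∧ g ∈ c.extent := by
  rw [← c.upperPolar_extent, mem_upperPolar_iff]
  push Not
  exact exists_congr fun g => and_comm

/-- The concept `c` is true at a position, seen from the point of view of `∃`. -/
def Position.Holds (c : F.Lat) : Position G M P X Y → Prop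
  | .obj g _ => g ∈ c.extent
  | .feat m _ => m ∉ c.intent

/-- The concept `c` has at a position the truth value that player `pl` defends. -/
def Position.Sat (c : F.Lat) (b : Position G M P X Y) : Player → Prop
  | .eloisa => b.Holds c
  | .abelard => ¬ b.Holds c

theorem Position.Holds.mono {c d : F.Lat} (h : c ≤ d) {b : Position G M P X Y} (hb : b.Holds c) :
    b.Holds d := by
  cases b with
  | obj g => exact Concept.extent_subset_extent_iff.2 h hb
  | feat m => exact fun hm => hb (Concept.intent_subset_intent_iff.2 h hm)

/-- Approximations err on the safe side: those used by `∃` lie below the least fixed point, those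
used by `∀` above the greatest one. -/
theorem Position.Sat.fixedPoint_of_value {pl : Player} {z : X ⊕ Y} {f : F.Lat →o F.Lat}
    {a : Ordinal} {b : Position G M P X Y} (h : b.Sat (value pl z f a) pl) :
    b.Sat (fixedPoint z f) pl := by
  cases pl <;> cases z
  · exact h
  · exact Position.Holds.mono (lfpApprox_le_of_mem_fixedPoints f f.map_lfp bot_le a) h
  · exact fun h' => h (Position.Holds.mono (le_gfpApprox_of_mem_fixedPoints f f.map_gfp le_top a) h')
  · exact h

/-- A position where `z` is unfolded that defends an approximation defends the unfolding of an
earlier approximation. -/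
theorem Position.Sat.exists_lt {pl : Player} {z : X ⊕ Y} {f : F.Lat →o F.Lat}
    {a : Ordinal} {b : Position G M P X Y} (hb : b.turn = unfolder z) (hz : unfolder z = pl)
    (h : b.Sat (value pl z f a) pl) : ∃ c < a, b.Sat (f (value pl z f c)) pl := by
  subst hz
  cases z with
  | inl x =>
    cases b with
    | feat m ψ => cases hb
    | obj g ψ =>
      change g ∉ (gfpApprox f ⊤ a).extent at h
      rw [gfpApprox] at h
      -- The extent of an infimum is an intersection, so falsity at `g` is witnessed by one stage.
      -- The extent of a supremum is no union; this is why the `μ` case is argued at `m` with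
      -- intents.
      simp only [top_inf_eq, Concept.extent_iInf, Set.mem_iInter, not_forall] at h
      obtain ⟨c, hc, h⟩ := h
      exact ⟨c, hc, h⟩
  | inr y =>
    cases b with
    | obj g ψ => cases hb
    | feat m ψ =>
      change m ∉ (lfpApprox f ⊥ a).intent at h
      rw [lfpApprox] at h
      simp only [bot_sup_eq, Concept.intent_iSup, Set.mem_iInter, not_forall] at h
      obtain ⟨c, hc, h⟩ := h
      exact ⟨c, hc, h⟩

theorem Position.Sat.exists_unfold {pl : Player} {z : X ⊕ Y} {f : F.Lat →o F.Lat}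
    {b : Position G M P X Y} (hb : b.turn = unfolder z) (h : b.Sat (fixedPoint z f) pl) :
    ∃ c, b.Sat (f (value pl z f c)) pl := by
  by_cases hz : unfolder z = pl
  · obtain ⟨a, ha⟩ := exists_value_eq_fixedPoint pl z f
    rw [← ha] at h
    obtain ⟨c, -, hc⟩ := h.exists_lt hb hz
    exact ⟨c, hc⟩
  · exact ⟨0, by rwa [value_of_unfolder_ne hz, map_fixedPoint]⟩

end Truth

/-! ### Interpretation of formulas -/

section Eval

variable {G : Type u} {M : Type v} {P X Y : Type*} [DecidableEq X] [DecidableEq Y]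
  {F : EnrichedPolarity G M} {V : P → F.Lat}

theorem eval_fix (z : X ⊕ Y) (ψ : Formula P X Y) (e : X ⊕ Y → F.Lat) :
    eval F V (.fix z ψ) e = fixedPoint z (sectionHom (eval F V ψ) z e) := by
  cases z <;> rfl

/-- The congruence of `eval` for `ψ` is a hypothesis so that the lemma can serve inside the
induction that proves `eval_congr`. -/
theorem sectionHom_congr_of {ψ : Formula P X Y} {z : X ⊕ Y} {e e' : X ⊕ Y → F.Lat}
    (hψ : ∀ e e' : X ⊕ Y → F.Lat, (∀ w ∈ ψ.freeVars, e w = e' w) → eval F V ψ e = eval F V ψ e')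
    (h : ∀ w ∈ ψ.freeVars, w ≠ z → e w = e' w) :
    sectionHom (eval F V ψ) z e = sectionHom (eval F V ψ) z e' := by
  ext1
  funext c
  refine hψ _ _ fun w hw => ?_
  by_cases hwz : w = z
  · subst hwz
    simp
  · simp [Function.update_of_ne hwz, h w hw hwz]

/-- The interpretation of a formula depends on its free variables only. -/
theorem eval_congr {ψ : Formula P X Y} {e e' : X ⊕ Y → F.Lat}
    (h : ∀ w ∈ ψ.freeVars, e w = e' w) : eval F V ψ e = eval F V ψ e' := by
  induction ψ generalizing e e' with
  | atom | bot | top => rfl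
  | var z => exact h z (Set.mem_singleton z)
  | or φ ψ ih₁ ih₂ =>
    exact congrArg₂ (· ⊔ ·) (ih₁ fun w hw => h w (Or.inl hw)) (ih₂ fun w hw => h w (Or.inr hw))
  | and φ ψ ih₁ ih₂ =>
    exact congrArg₂ (· ⊓ ·) (ih₁ fun w hw => h w (Or.inl hw)) (ih₂ fun w hw => h w (Or.inr hw))
  | box ψ ih => exact congrArg F.box (ih h)
  | dia ψ ih => exact congrArg F.dia (ih h)
  | mu y ψ ih =>
    exact congrArg OrderHom.lfp (sectionHom_congr_of (fun _ _ => ih) fun w hw hne => h w ⟨hw, hne⟩)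
  | nu x ψ ih =>
    exact congrArg OrderHom.gfp (sectionHom_congr_of (fun _ _ => ih) fun w hw hne => h w ⟨hw, hne⟩)

theorem sectionHom_congr {ψ : Formula P X Y} {z : X ⊕ Y} {e e' : X ⊕ Y → F.Lat}
    (h : ∀ w ∈ ψ.freeVars, w ≠ z → e w = e' w) :
    sectionHom (eval F V ψ) z e = sectionHom (eval F V ψ) z e' :=
  sectionHom_congr_of (fun _ _ => eval_congr) h

end Eval

/-! ### Moves of the evaluation game -/

section Moves

variable {G : Type u} {M : Type v} {P X Y : Type*}
  {F : EnrichedPolarity G M} {V : P → F.Lat} {e : X ⊕ Y → F.Lat} {φ : Formula P X Y}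

/-- A position with a fixed point formula for `z` and body `χ` where `z` is unfolded. -/
def Position.IsFix (b : Position G M P X Y) (z : X ⊕ Y) (χ : Formula P X Y) : Prop :=
  b.turn = unfolder z ∧ b.formula = .fix z χ

/-- A position with the variable `z` where `z` is unfolded. -/
def Position.IsVar (b : Position G M P X Y) (z : X ⊕ Y) : Prop :=
  b.turn = unfolder z ∧ b.formula = .var z

theorem Position.IsFix.moves_eq {b : Position G M P X Y} {z : X ⊕ Y} {χ : Formula P X Y}
    (h : b.IsFix z χ) : ∃ b', evalMoves F V e φ b = {b'} ∧ b'.formula = χ ∧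
      ∀ (c : F.Lat) pl, b'.Sat c pl ↔ b.Sat c pl := by
  obtain ⟨h₁, h₂⟩ := h
  cases b with
  | obj g ψ =>
    cases z with
    | inr y => cases h₁
    | inl x =>
      cases h₂
      exact ⟨.obj g χ, rfl, rfl, fun c pl => by cases pl <;> rfl⟩
  | feat m ψ =>
    cases z with
    | inl x => cases h₁
    | inr y =>
      cases h₂
      exact ⟨.feat m χ, rfl, rfl, fun c pl => by cases pl <;> rfl⟩

theorem Position.IsVar.moves_eq (hφ : φ.Clean) {b : Position G M P X Y} {z : X ⊕ Y}
    {χ : Formula P X Y} (hχ : φ.IsBody z χ) (h : b.IsVar z) :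
    ∃ b', evalMoves F V e φ b = {b'} ∧ b'.IsFix z χ ∧
      ∀ (c : F.Lat) pl, b'.Sat c pl ↔ b.Sat c pl := by
  obtain ⟨h₁, h₂⟩ := h
  have hb : z ∈ φ.boundVars := ⟨χ, hχ⟩
  cases b with
  | obj g ψ =>
    cases z with
    | inr y => cases h₁
    | inl x =>
      cases h₂
      refine ⟨.obj g (.nu x χ), Set.ext fun b' => ⟨?_, ?_⟩, ⟨rfl, rfl⟩, fun c pl => by cases pl <;> rfl⟩
      · rintro (⟨ψ, hψ, rfl⟩ | ⟨h, -⟩)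
        · rw [hφ.2 _ ψ χ hψ hχ]
          rfl
        · exact absurd hb h
      · rintro rfl
        exact Or.inl ⟨χ, hχ, rfl⟩
  | feat m ψ =>
    cases z with
    | inl x => cases h₁
    | inr y =>
      cases h₂
      refine ⟨.feat m (.mu y χ), Set.ext fun b' => ⟨?_, ?_⟩, ⟨rfl, rfl⟩, fun c pl => by cases pl <;> rfl⟩
      · rintro (⟨ψ, hψ, rfl⟩ | ⟨h, -⟩)
        · rw [hφ.2 _ ψ χ hψ hχ]
          rfl
        · exact absurd hb h
      · rintro rfl
        exact Or.inl ⟨χ, hχ, rfl⟩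

/-- Positions whose moves only decompose the formula. -/
def Position.Plain (φ : Formula P X Y) (b : Position G M P X Y) : Prop :=
  (∀ z χ, ¬ b.IsFix z χ) ∧ ∀ z ∈ φ.boundVars, ¬ b.IsVar z

theorem Position.Plain.moves_subformula {b b' : Position G M P X Y} (hb : b.Plain φ)
    (h : b' ∈ evalMoves F V e φ b) :
    b'.formula ∈ b.formula.subformulas ∧ b'.formula.freeVars ⊆ b.formula.freeVars := by
  have bounce : b'.formula = b.formula → b'.formula ∈ b.formula.subformulas ∧
      b'.formula.freeVars ⊆ b.formula.freeVars :=
    fun h => h ▸ ⟨Formula.mem_subformulas_self _, subset_rfl⟩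
  cases b with
  | obj g ψ =>
    cases ψ with
    | atom p => obtain ⟨-, m, -, rfl⟩ := h; exact bounce rfl
    | top => exact h.elim
    | bot | or | dia | mu => obtain ⟨m, -, rfl⟩ := h; exact bounce rfl
    | and ψ₁ ψ₂ =>
      rcases h with rfl | rfl
      · exact ⟨Or.inr (Or.inl (Formula.mem_subformulas_self _)), Set.subset_union_left⟩
      · exact ⟨Or.inr (Or.inr (Formula.mem_subformulas_self _)), Set.subset_union_right⟩
    | box ψ =>
      obtain ⟨m, -, rfl⟩ := h
      exact ⟨Or.inr (Formula.mem_subformulas_self _), subset_rfl⟩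
    | nu x ψ => exact absurd ⟨rfl, rfl⟩ (hb.1 (.inl x) ψ)
    | var z =>
      cases z with
      | inl x =>
        rcases h with ⟨χ, hχ, -⟩ | ⟨-, -, m, -, rfl⟩
        · exact absurd ⟨rfl, rfl⟩ (hb.2 (.inl x) ⟨χ, hχ⟩)
        · exact bounce rfl
      | inr y => obtain ⟨-, m, -, rfl⟩ := h; exact bounce rfl
  | feat m ψ =>
    cases ψ with
    | atom p => obtain ⟨-, g, -, rfl⟩ := h; exact bounce rfl
    | bot => exact h.elim
    | top | and | box | nu => obtain ⟨g, -, rfl⟩ := h; exact bounce rfl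
    | or ψ₁ ψ₂ =>
      rcases h with rfl | rfl
      · exact ⟨Or.inr (Or.inl (Formula.mem_subformulas_self _)), Set.subset_union_left⟩
      · exact ⟨Or.inr (Or.inr (Formula.mem_subformulas_self _)), Set.subset_union_right⟩
    | dia ψ =>
      obtain ⟨g, -, rfl⟩ := h
      exact ⟨Or.inr (Formula.mem_subformulas_self _), subset_rfl⟩
    | mu y ψ => exact absurd ⟨rfl, rfl⟩ (hb.1 (.inr y) ψ)
    | var z =>
      cases z with
      | inr y =>
        rcases h with ⟨χ, hχ, -⟩ | ⟨-, -, g, -, rfl⟩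
        · exact absurd ⟨rfl, rfl⟩ (hb.2 (.inr y) ⟨χ, hχ⟩)
        · exact bounce rfl
      | inl x => obtain ⟨-, g, -, rfl⟩ := h; exact bounce rfl

theorem Position.isFix_or_isVar_or_plain (φ : Formula P X Y) (b : Position G M P X Y) :
    (∃ z χ, b.IsFix z χ) ∨ (∃ z χ, φ.IsBody z χ ∧ b.IsVar z) ∨ b.Plain φ := by
  by_cases h₁ : ∃ z χ, b.IsFix z χ
  · exact Or.inl h₁
  · by_cases h₂ : ∃ z χ, φ.IsBody z χ ∧ b.IsVar z
    · exact Or.inr (Or.inl h₂)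
    · push Not at h₁ h₂
      exact Or.inr (Or.inr ⟨h₁, fun z ⟨χ, hχ⟩ => h₂ z χ hχ⟩)

theorem move_formula (hφ : φ.Clean) {b b' : Position G M P X Y} (h : b' ∈ evalMoves F V e φ b) :
    b'.formula ∈ b.formula.subformulas ∨
      ∃ z χ, φ.IsBody z χ ∧ b.formula = .var z ∧ b'.formula = .fix z χ := by
  rcases b.isFix_or_isVar_or_plain φ with ⟨z, χ, hb⟩ | ⟨z, χ, hχ, hb⟩ | hb
  · obtain ⟨b'', hm, hf, -⟩ := hb.moves_eq (F := F) (V := V) (e := e) (φ := φ)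
    rw [hm] at h
    rw [Set.mem_singleton_iff.1 h, hf, hb.2, Formula.subformulas_fix]
    exact Or.inl (Or.inr (Formula.mem_subformulas_self _))
  · obtain ⟨b'', hm, hf, -⟩ := hb.moves_eq (F := F) (V := V) (e := e) hφ hχ
    rw [hm] at h
    rw [Set.mem_singleton_iff.1 h]
    exact Or.inr ⟨z, χ, hχ, hb.2, hf.2⟩
  · exact Or.inl (hb.moves_subformula h).1

/-! ### Truth at a plain position and truth after one move -/

section Local

variable [DecidableEq X] [DecidableEq Y] {ρ : X ⊕ Y → F.Lat}

/-- Most moves only pass from `g` to the features not incident with it, where the equivalence is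
`mem_extent_iff`. The cases of `∧` and `□` are the definitions of their extents, and a true atom or
unbound variable leaves `∀` without a move. -/
theorem Position.Plain.holds_iff_of_abelard {b : Position G M P X Y} (hb : b.Plain φ)
    (ht : b.turn = .abelard) (hρ : ∀ z ∉ φ.boundVars, ρ z = e z) :
    b.Holds (eval F V b.formula ρ) ↔
      ∀ b' ∈ evalMoves F V e φ b, b'.Holds (eval F V b'.formula ρ) := by
  have bounce : ∀ g (ψ : Formula P X Y), g ∈ (eval F V ψ ρ).extent ↔
      ∀ b' ∈ toFeat F g ψ, b'.Holds (eval F V b'.formula ρ) := by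
    intro g ψ
    rw [mem_extent_iff]
    refine ⟨?_, fun h m hm => h _ ⟨m, hm, rfl⟩⟩
    rintro h _ ⟨m, hm, rfl⟩
    exact h m hm
  cases b with
  | feat m ψ => cases ht
  | obj g ψ =>
    change g ∈ (eval F V ψ ρ).extent ↔ _
    cases ψ with
    | atom p =>
      by_cases hg : g ∈ (eval F V (.atom p : Formula P X Y) ρ).extent
      · exact ⟨fun _ b' h => absurd hg h.1, fun _ => hg⟩
      · rw [bounce]
        exact forall_congr' fun b' => ⟨fun h h' => h h'.2, fun h h' => h ⟨hg, h'⟩⟩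
    | top => exact ⟨fun _ b' h => h.elim, fun _ => Set.mem_univ g⟩
    | bot | or | dia | mu => exact bounce g _
    | and ψ₁ ψ₂ =>
      refine ⟨?_, fun h => ⟨h _ (Or.inl rfl), h _ (Or.inr rfl)⟩⟩
      rintro h _ (rfl | rfl)
      · exact h.1
      · exact h.2
    | box ψ =>
      refine ⟨?_, fun h m hm => not_not.1 fun hR => h _ ⟨m, hR, rfl⟩ hm⟩
      rintro h _ ⟨m, hm, rfl⟩ hmi
      exact hm (h hmi)
    | nu x ψ => exact absurd ⟨rfl, rfl⟩ (hb.1 (.inl x) ψ)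
    | var z =>
      have hev : ∀ z, z ∉ φ.boundVars → eval F V (.var z : Formula P X Y) ρ = e z := hρ
      cases z with
      | inl x =>
        have hx : .inl x ∉ φ.boundVars := fun h => hb.2 (.inl x) h ⟨rfl, rfl⟩
        by_cases hg : g ∈ (e (.inl x)).extent
        · rw [hev _ hx]
          refine ⟨fun _ b' h => ?_, fun _ => hg⟩
          rcases h with ⟨χ, hχ, -⟩ | h
          · exact absurd ⟨χ, hχ⟩ hx
          · exact absurd hg h.2.1
        · rw [bounce]
          refine forall_congr' fun b' => ⟨fun h h' => ?_, fun h h' => h (Or.inr ⟨hx, hg, h'⟩)⟩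
          rcases h' with ⟨χ, hχ, -⟩ | h'
          · exact absurd ⟨χ, hχ⟩ hx
          · exact h h'.2.2
      | inr y =>
        by_cases hg : .inr y ∈ φ.boundVars ∨ g ∉ (e (.inr y)).extent
        · rw [bounce]
          exact forall_congr' fun b' => ⟨fun h h' => h h'.2, fun h h' => h ⟨hg, h'⟩⟩
        · push Not at hg
          rw [hev _ hg.1]
          exact ⟨fun _ b' h => (h.1.elim hg.1 fun h => h hg.2).elim, fun _ => hg.2⟩

theorem Position.Plain.holds_iff_of_eloisa {b : Position G M P X Y} (hb : b.Plain φ)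
    (ht : b.turn = .eloisa) (hρ : ∀ z ∉ φ.boundVars, ρ z = e z) :
    b.Holds (eval F V b.formula ρ) ↔
      ∃ b' ∈ evalMoves F V e φ b, b'.Holds (eval F V b'.formula ρ) := by
  have bounce : ∀ m (ψ : Formula P X Y), m ∉ (eval F V ψ ρ).intent ↔
      ∃ b' ∈ toObj F m ψ, b'.Holds (eval F V b'.formula ρ) := by
    intro m ψ
    rw [notMem_intent_iff]
    refine ⟨fun ⟨g, hg, h⟩ => ⟨_, ⟨g, hg, rfl⟩, h⟩, ?_⟩
    rintro ⟨_, ⟨g, hg, rfl⟩, h⟩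
    exact ⟨g, hg, h⟩
  cases b with
  | obj g ψ => cases ht
  | feat m ψ =>
    change m ∉ (eval F V ψ ρ).intent ↔ _
    cases ψ with
    | atom p =>
      by_cases hm : m ∈ (eval F V (.atom p : Formula P X Y) ρ).intent
      · exact ⟨fun h => absurd hm h, fun ⟨b', h, _⟩ => h.1⟩
      · rw [bounce]
        exact exists_congr fun b' => and_congr_left fun _ => ⟨fun h => ⟨hm, h⟩, fun h => h.2⟩
    | bot => exact ⟨fun h => absurd (Set.mem_univ m) h, fun ⟨b', h, _⟩ => h.elim⟩
    | top | and | box | nu => exact bounce m _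
    | or ψ₁ ψ₂ =>
      change ¬ (_ ∧ _) ↔ _
      rw [not_and_or]
      constructor
      · rintro (h | h)
        · exact ⟨_, Or.inl rfl, h⟩
        · exact ⟨_, Or.inr rfl, h⟩
      · rintro ⟨_, rfl | rfl, h⟩
        · exact Or.inl h
        · exact Or.inr h
    | dia ψ =>
      constructor
      · intro h
        by_contra! hcon
        exact h fun g hg => not_not.1 fun hR => hcon _ ⟨g, hR, rfl⟩ hg
      · rintro ⟨_, ⟨g, hg, rfl⟩, h⟩ h'
        exact hg (h' h)
    | mu y ψ => exact absurd ⟨rfl, rfl⟩ (hb.1 (.inr y) ψ)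
    | var z =>
      have hev : ∀ z, z ∉ φ.boundVars → eval F V (.var z : Formula P X Y) ρ = e z := hρ
      cases z with
      | inr y =>
        have hy : .inr y ∉ φ.boundVars := fun h => hb.2 (.inr y) h ⟨rfl, rfl⟩
        by_cases hm : m ∈ (e (.inr y)).intent
        · rw [hev _ hy]
          refine ⟨fun h => absurd hm h, fun ⟨b', h, _⟩ => ?_⟩
          rcases h with ⟨χ, hχ, -⟩ | h
          · exact absurd ⟨χ, hχ⟩ hy
          · exact h.2.1
        · rw [bounce]
          refine exists_congr fun b' => and_congr_left fun _ =>
            ⟨fun h => Or.inr ⟨hy, hm, h⟩, fun h => ?_⟩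
          rcases h with ⟨χ, hχ, -⟩ | h
          · exact absurd ⟨χ, hχ⟩ hy
          · exact h.2.2
      | inl x =>
        by_cases hm : .inl x ∈ φ.boundVars ∨ m ∉ (e (.inl x)).intent
        · rw [bounce]
          exact exists_congr fun b' => and_congr_left fun _ => ⟨fun h => ⟨hm, h⟩, fun h => h.2⟩
        · push Not at hm
          rw [hev _ hm.1]
          exact ⟨fun h => absurd hm.2 h, fun ⟨b', h, _⟩ => (h.1.elim hm.1 fun h => h hm.2).elim⟩

end Local

end Moves

/-! ### Moves that keep the formula -/

section Bounce

variable {G : Type u} {M : Type v} {P X Y : Type*}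
  {F : EnrichedPolarity G M} {V : P → F.Lat} {e : X ⊕ Y → F.Lat} {φ : Formula P X Y}

theorem Player.eq_of_ne_of_ne {p q r : Player} (h₁ : p ≠ q) (h₂ : r ≠ q) : p = r := by
  cases p <;> cases q <;> cases r <;> first | rfl | exact absurd rfl h₁ | exact absurd rfl h₂

theorem Position.IsFix.unique {b : Position G M P X Y} {z w : X ⊕ Y} {χ θ : Formula P X Y}
    (h₁ : b.IsFix z χ) (h₂ : b.IsFix w θ) : z = w ∧ χ = θ :=
  Formula.fix_inj.1 (h₁.2.symm.trans h₂.2)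

theorem Position.IsVar.not_isFix {b : Position G M P X Y} {z w : X ⊕ Y} {θ : Formula P X Y}
    (h₁ : b.IsVar z) : ¬ b.IsFix w θ := by
  intro h₂
  have := h₁.2.symm.trans h₂.2
  cases w <;> cases this

/-- A move that stays on the same side decomposes the formula or unfolds a variable, and so changes
the formula. -/
theorem turn_ne_of_move_of_formula_eq {b b' : Position G M P X Y}
    (h : b' ∈ evalMoves F V e φ b) (hf : b'.formula = b.formula) : b'.turn ≠ b.turn := by
  cases b with
  | obj g ψ =>
    cases b' with
    | feat m ψ' => exact nofun
    | obj g' ψ' =>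
      replace hf : ψ' = ψ := hf
      have hs := congrArg Formula.size hf
      cases ψ with
      | atom p => obtain ⟨-, m, -, h⟩ := h; cases h
      | top => exact h.elim
      | bot | or | dia | mu | box => obtain ⟨m, -, h⟩ := h; cases h
      | and ψ₁ ψ₂ =>
        rcases h with h | h <;> cases h <;> simp only [Formula.size] at hs <;> omega
      | nu x ψ => cases h; simp only [Formula.size] at hs; omega
      | var z =>
        cases z with
        | inl x =>
          rcases h with ⟨χ, -, h⟩ | ⟨-, -, m, -, h⟩
          · cases h; cases hf
          · cases h
        | inr y => obtain ⟨-, m, -, h⟩ := h; cases h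
  | feat m ψ =>
    cases b' with
    | obj g ψ' => exact nofun
    | feat m' ψ' =>
      replace hf : ψ' = ψ := hf
      have hs := congrArg Formula.size hf
      cases ψ with
      | atom p => obtain ⟨-, g, -, h⟩ := h; cases h
      | bot => exact h.elim
      | top | and | box | nu | dia => obtain ⟨g, -, h⟩ := h; cases h
      | or ψ₁ ψ₂ =>
        rcases h with h | h <;> cases h <;> simp only [Formula.size] at hs <;> omega
      | mu y ψ => cases h; simp only [Formula.size] at hs; omega
      | var z =>
        cases z with
        | inr y =>
          rcases h with ⟨χ, -, h⟩ | ⟨-, -, g, -, h⟩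
          · cases h; cases hf
          · cases h
        | inl x => obtain ⟨-, g, -, h⟩ := h; cases h

/-- From a true position `(g, ψ)` the formula cannot be kept for two moves. -/
theorem formula_ne_of_two_moves [DecidableEq X] [DecidableEq Y] {ρ : X ⊕ Y → F.Lat}
    (hρ : ∀ z ∉ φ.boundVars, ρ z = e z) {b b' b'' : Position G M P X Y}
    (ht : b.turn = .abelard) (hb : b.Holds (eval F V b.formula ρ))
    (h : b' ∈ evalMoves F V e φ b) (h' : b'' ∈ evalMoves F V e φ b')
    (hf : b'.formula = b.formula) : b''.formula ≠ b'.formula := by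
  intro hf'
  have ht' := turn_ne_of_move_of_formula_eq h hf
  have ht'' := turn_ne_of_move_of_formula_eq h' hf'
  cases b with
  | feat m ψ => cases ht
  | obj g ψ =>
  cases b' with
  | obj g ψ => exact ht' rfl
  | feat m ψ' =>
  cases b'' with
  | feat m ψ => exact ht'' rfl
  | obj g' ψ'' =>
    cases (show ψ' = ψ from hf)
    cases (show ψ'' = ψ from hf')
    -- Every connective is decomposed, and every bound variable unfolded, either at objects or at
    -- features, so one of the two moves would change the formula. In the other cases one of the two
    -- positions has no move: truth at `g` stops atoms and unbound variables.
    cases ψ with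
    | atom p => exact h.1 hb
    | top => exact h
    | bot => exact h'
    | or => rcases h' with h' | h' <;> cases h'
    | and => rcases h with h | h <;> cases h
    | mu => cases h'
    | nu => cases h
    | box ψ =>
      obtain ⟨m', -, h⟩ := h
      have := congrArg (fun b => b.formula.size) h
      simp [Position.formula, Formula.size] at this
    | dia ψ =>
      obtain ⟨m', -, h'⟩ := h'
      have := congrArg (fun b => b.formula.size) h'
      simp [Position.formula, Formula.size] at this
    | var z =>
      cases z with
      | inl x =>
        rcases h with ⟨χ, -, h⟩ | ⟨hx, hg, -⟩
        · cases h
        · exact hg (hρ _ hx ▸ hb)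
      | inr y =>
        rcases h' with ⟨χ, -, h'⟩ | ⟨hy, -⟩
        · cases h'
        · exact h.1.elim hy fun hg => hg (hρ _ hy ▸ hb)

/-- A play that stays below the binder of `z` can reach the binder only from the variable `z`, or by
a preliminary move at the binder itself. -/
theorem isFix_of_move (hφ : φ.Clean) {b b' : Position G M P X Y} {z : X ⊕ Y} {χ : Formula P X Y}
    (h : b' ∈ evalMoves F V e φ b) (hb' : b'.formula = .fix z χ)
    (hb : b.formula ∈ (Formula.fix z χ).subformulas) :
    b'.IsFix z χ ∧ (b.IsVar z ∨ b.formula = .fix z χ ∧ ¬ b.IsFix z χ) := by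
  have hle := Formula.size_le_of_mem_subformulas hb
  rcases b.isFix_or_isVar_or_plain φ with ⟨w, θ, hw⟩ | ⟨w, θ, hθ, hw⟩ | hp
  · obtain ⟨b'', hm, hf, -⟩ := hw.moves_eq (F := F) (V := V) (e := e) (φ := φ)
    rw [hm] at h
    rw [Set.mem_singleton_iff.1 h, hf] at hb'
    rw [hw.2, Formula.size_fix, hb'] at hle
    omega
  · obtain ⟨b'', hm, hf, -⟩ := hw.moves_eq (F := F) (V := V) (e := e) hφ hθ
    rw [hm] at h
    rw [← Set.mem_singleton_iff.1 h] at hf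
    obtain ⟨rfl, rfl⟩ := Formula.fix_inj.1 (hf.2.symm.trans hb')
    exact ⟨hf, Or.inl hw⟩
  · have hsub := (hp.moves_subformula h).1
    rw [hb'] at hsub
    have heq : b.formula = .fix z χ := by
      rcases Formula.eq_or_size_lt_of_mem_subformulas hb with h' | h'
      · exact h'
      · exact absurd (Formula.size_le_of_mem_subformulas hsub) (not_le.2 h')
    have hnf := hp.1 z χ
    have ht : b.turn ≠ unfolder z := fun h' => hnf ⟨h', heq⟩
    exact ⟨⟨Player.eq_of_ne_of_ne (turn_ne_of_move_of_formula_eq h (hb'.trans heq.symm)) ht.symm, hb'⟩,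
      Or.inr ⟨heq, hnf⟩⟩

end Bounce

/-! ### Annotated positions -/

/-- A position together with values for the variables and ordinals for the approximations among
them. -/
structure GameState {G : Type u} {M : Type v} (F : EnrichedPolarity G M) (P X Y : Type*) where
  pos : Position G M P X Y
  env : X ⊕ Y → F.Lat
  rank : X ⊕ Y → Ordinal.{max u v}

section States

variable {G : Type u} {M : Type v} {P X Y : Type*} [DecidableEq X] [DecidableEq Y]
  {F : EnrichedPolarity G M} {V : P → F.Lat} {e : X ⊕ Y → F.Lat} {φ : Formula P X Y}
  {pl : Player}

/-- Player `pl` defends the truth value of the formula of the state, where the values of the active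
variables are those that `pl` works with. -/
structure GameState.Good (V : P → F.Lat) (e : X ⊕ Y → F.Lat) (φ : Formula P X Y) (pl : Player)
    (s : GameState F P X Y) : Prop where
  mem : s.pos.formula ∈ φ.subformulas
  sat : s.pos.Sat (eval F V s.pos.formula s.env) pl
  env_eq : ∀ z ∉ φ.boundVars, s.env z = e z
  active : ∀ z χ, φ.Active s.pos.formula z → φ.IsBody z χ →
    s.env z = value pl z (sectionHom (eval F V χ) z s.env) (s.rank z)

/-- An admissible move to another good state. The values and ranks change only when a fixed point formula
is unfolded; then the rank of the variable becomes the least possible one. -/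
structure GameState.Step (V : P → F.Lat) (e : X ⊕ Y → F.Lat) (φ : Formula P X Y) (pl : Player)
    (s s' : GameState F P X Y) : Prop where
  move : s'.pos ∈ evalMoves F V e φ s.pos
  good : s'.Good V e φ pl
  same : (∀ z χ, ¬ s.pos.IsFix z χ) → s'.env = s.env ∧ s'.rank = s.rank
  other : ∀ z χ, s.pos.IsFix z χ → ∀ w ≠ z, s'.rank w = s.rank w
  least : ∀ z χ, s.pos.IsFix z χ → ∀ a,
    s.pos.Sat (sectionHom (eval F V χ) z s.env (value pl z (sectionHom (eval F V χ) z s.env) a)) pl →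
      s'.rank z ≤ a

/-- The variable `z` gets a fresh value. The variables active afterwards are `z` and those active in
`fix z χ`; `z` is not among the latter, so none of their section maps sees the change and the
invariant survives. -/
theorem GameState.Good.exists_step_of_isFix (hφ : φ.Clean) {s : GameState F P X Y}
    (hs : s.Good V e φ pl) {z : X ⊕ Y} {χ : Formula P X Y} (hz : s.pos.IsFix z χ)
    {b : Position G M P X Y} (hb : b ∈ evalMoves F V e φ s.pos) :
    ∃ s', s.Step V e φ pl s' ∧ s'.pos = b := by
  obtain ⟨b', hm, hf, hsat⟩ := hz.moves_eq (F := F) (V := V) (e := e) (φ := φ)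
  have hbb' : b = b' := by rwa [hm] at hb
  subst hbb'
  have hχ : φ.IsBody z χ := (congrArg (· ∈ φ.subformulas) hz.2).mp hs.mem
  set f := sectionHom (eval F V χ) z s.env with hfdef
  have hex : {c | s.pos.Sat (f (value pl z f c)) pl}.Nonempty := by
    refine Position.Sat.exists_unfold hz.1 ?_
    have := hs.sat
    rwa [hz.2, eval_fix] at this
  -- Taking the least ordinal is what makes the rank drop when the play returns to this binder.
  obtain ⟨a, ha, hmin⟩ := WellFounded.has_min (wellFounded_lt (α := Ordinal)) _ hex
  have hsec : ∀ w θ, φ.IsBody w θ → (w = z ∨ φ.Active (.fix z χ) w) →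
      sectionHom (eval F V θ) w (Function.update s.env z (value pl z f a)) =
        sectionHom (eval F V θ) w s.env := by
    intro w θ hθ hw
    refine sectionHom_congr fun u hu huw => Function.update_of_ne ?_ _ _
    rintro rfl
    rcases hw with rfl | hw
    · exact huw rfl
    · exact hφ.not_active_fix_self hχ (.dep hw ⟨⟨χ, hχ⟩, θ, hθ, hu⟩)
  refine ⟨⟨b, Function.update s.env z (value pl z f a), Function.update s.rank z a⟩,
    ⟨hb, ⟨?_, ?_, ?_, ?_⟩, fun h => absurd hz (h z χ), ?_, ?_⟩, rfl⟩
  · exact hf ▸ Formula.body_mem_subformulas hχ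
  · change b.Sat (eval F V b.formula _) pl
    rw [hsat, hf]
    exact ha
  · intro w hw
    rw [← hs.env_eq w hw]
    exact Function.update_of_ne (by rintro rfl; exact hw ⟨χ, hχ⟩) _ _
  · intro w θ hw hθ
    dsimp only at hw ⊢
    rw [hf] at hw
    have hw' := hφ.active_body hχ hw
    rw [hsec w θ hθ hw']
    by_cases hwz : w = z
    · subst hwz
      rw [hφ.2 w θ χ hθ hχ, Function.update_self, Function.update_self]
    · rw [Function.update_of_ne hwz, Function.update_of_ne hwz]
      exact hs.active w θ (hz.2 ▸ hw'.resolve_left hwz) hθ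
  · intro w θ hw u hu
    obtain ⟨rfl, -⟩ := hz.unique hw
    exact Function.update_of_ne hu _ _
  · intro w θ hw c hc
    obtain ⟨rfl, rfl⟩ := hz.unique hw
    change Function.update s.rank z a z ≤ c
    rw [Function.update_self]
    exact not_lt.1 (hmin c hc)

/-- The value of `z` is weakened from an approximation to the fixed point itself. The rank is kept,
so that the next move can be compared with it. -/
theorem GameState.Good.exists_step_of_isVar (hφ : φ.Clean) {s : GameState F P X Y}
    (hs : s.Good V e φ pl) {z : X ⊕ Y} {χ : Formula P X Y} (hχ : φ.IsBody z χ) (hz : s.pos.IsVar z)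
    {b : Position G M P X Y} (hb : b ∈ evalMoves F V e φ s.pos) :
    ∃ s', s.Step V e φ pl s' ∧ s'.pos = b := by
  obtain ⟨b', hm, hf, hsat⟩ := hz.moves_eq (F := F) (V := V) (e := e) hφ hχ
  have hbb' : b = b' := by rwa [hm] at hb
  subst hbb'
  refine ⟨⟨b, s.env, s.rank⟩, ⟨hb, ⟨?_, ?_, hs.env_eq, ?_⟩, fun _ => ⟨rfl, rfl⟩,
    fun w θ h => absurd h hz.not_isFix, fun w θ h => absurd h hz.not_isFix⟩, rfl⟩
  · exact hf.2 ▸ hχ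
  · have h := hs.sat
    have ha := hs.active z χ (hz.2 ▸ .free (Set.mem_singleton z) ⟨χ, hχ⟩) hχ
    rw [hz.2, show eval F V (.var z : Formula P X Y) s.env = s.env z from rfl, ha] at h
    change b.Sat (eval F V b.formula _) pl
    rw [hsat, hf.2, eval_fix]
    exact h.fixedPoint_of_value
  · intro w θ hw hθ
    refine hs.active w θ ?_ hθ
    rw [hz.2]
    exact Formula.Active.var_of_fix hχ (hf.2 ▸ hw)

theorem GameState.Good.step_of_plain {s : GameState F P X Y} (hs : s.Good V e φ pl)
    (hp : s.pos.Plain φ) {b : Position G M P X Y} (hb : b ∈ evalMoves F V e φ s.pos)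
    (hsat : b.Sat (eval F V b.formula s.env) pl) : s.Step V e φ pl ⟨b, s.env, s.rank⟩ := by
  have hsub := hp.moves_subformula hb
  exact ⟨hb, ⟨Formula.subformulas_subset hs.mem hsub.1, hsat, hs.env_eq,
    fun w θ hw hθ => hs.active w θ (hw.mono hsub.2) hθ⟩, fun _ => ⟨rfl, rfl⟩,
    fun w θ h => absurd h (hp.1 w θ), fun w θ h => absurd h (hp.1 w θ)⟩

theorem GameState.Good.exists_step_of_turn (hφ : φ.Clean) {s : GameState F P X Y}
    (hs : s.Good V e φ pl) (ht : s.pos.turn = pl) : ∃ s', s.Step V e φ pl s' := by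
  rcases s.pos.isFix_or_isVar_or_plain φ with ⟨z, χ, hz⟩ | ⟨z, χ, hχ, hz⟩ | hp
  · obtain ⟨b', hm, -⟩ := hz.moves_eq (F := F) (V := V) (e := e) (φ := φ)
    obtain ⟨s', h, -⟩ := hs.exists_step_of_isFix hφ hz (hm ▸ Set.mem_singleton b')
    exact ⟨s', h⟩
  · obtain ⟨b', hm, -⟩ := hz.moves_eq (F := F) (V := V) (e := e) hφ hχ
    obtain ⟨s', h, -⟩ := hs.exists_step_of_isVar hφ hχ hz (hm ▸ Set.mem_singleton b')
    exact ⟨s', h⟩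
  · have hsat := hs.sat
    cases pl with
    | eloisa =>
      obtain ⟨b, hb, h⟩ := (hp.holds_iff_of_eloisa ht hs.env_eq).1 hsat
      exact ⟨_, hs.step_of_plain hp hb h⟩
    | abelard =>
      have h := mt (hp.holds_iff_of_abelard ht hs.env_eq).2 hsat
      push Not at h
      obtain ⟨b, hb, h⟩ := h
      exact ⟨_, hs.step_of_plain hp hb h⟩

theorem GameState.Good.exists_step_of_turn_ne (hφ : φ.Clean) {s : GameState F P X Y}
    (hs : s.Good V e φ pl) (ht : s.pos.turn ≠ pl) {b : Position G M P X Y}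
    (hb : b ∈ evalMoves F V e φ s.pos) : ∃ s', s.Step V e φ pl s' ∧ s'.pos = b := by
  rcases s.pos.isFix_or_isVar_or_plain φ with ⟨z, χ, hz⟩ | ⟨z, χ, hχ, hz⟩ | hp
  · exact hs.exists_step_of_isFix hφ hz hb
  · exact hs.exists_step_of_isVar hφ hχ hz hb
  · refine ⟨_, hs.step_of_plain hp hb ?_, rfl⟩
    have hsat := hs.sat
    cases pl with
    | eloisa =>
      exact (hp.holds_iff_of_abelard (Player.eq_of_ne_of_ne (q := .eloisa) ht nofun)
        hs.env_eq).1 hsat b hb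
    | abelard =>
      exact fun h => hsat ((hp.holds_iff_of_eloisa (Player.eq_of_ne_of_ne (q := .abelard) ht nofun)
        hs.env_eq).2 ⟨b, hb, h⟩)

/-! ### Infinite runs -/

variable {s : ℕ → GameState F P X Y}

theorem isTrace_of_steps (hφ : φ.Clean) (h₀ : (s 0).Good V e φ pl)
    (hs : ∀ n, (s n).Step V e φ pl (s (n + 1))) : φ.IsTrace fun n => (s n).pos.formula :=
  ⟨h₀.mem, fun n => move_formula hφ (hs n).move⟩

theorem good_of_steps (h₀ : (s 0).Good V e φ pl)
    (hs : ∀ n, (s n).Step V e φ pl (s (n + 1))) (n : ℕ) : (s n).Good V e φ pl := by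
  cases n with
  | zero => exact h₀
  | succ n => exact (hs n).good

theorem exists_isFix_of_var (hφ : φ.Clean) (hs : ∀ n, (s n).Step V e φ pl (s (n + 1)))
    {z : X ⊕ Y} {χ : Formula P X Y} (hχ : φ.IsBody z χ) {n : ℕ}
    (hn : (s n).pos.formula = .var z) : ∃ k ≥ n, (s k).pos.IsFix z χ := by
  have step : ∀ k, (s k).pos.IsVar z → (s (k + 1)).pos.IsFix z χ := by
    intro k hk
    obtain ⟨b', hm, hf, -⟩ := hk.moves_eq (F := F) (V := V) (e := e) hφ hχ
    have := (hs k).move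
    rw [hm] at this
    rwa [Set.mem_singleton_iff.1 this]
  by_cases ht : (s n).pos.turn = unfolder z
  · exact ⟨n + 1, n.le_succ, step n ⟨ht, hn⟩⟩
  · have hp : (s n).pos.Plain φ := by
      refine ⟨fun w θ h => ?_, fun w _ h => ?_⟩
      · have := hn.symm.trans h.2
        cases w <;> cases this
      · cases hn.symm.trans h.2
        exact ht h.1
    have hf : (s (n + 1)).pos.formula = .var z := by
      have := (hp.moves_subformula (hs n).move).1
      rwa [hn] at this
    exact ⟨n + 2, by omega, step (n + 1) ⟨Player.eq_of_ne_of_ne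
      (turn_ne_of_move_of_formula_eq (hs n).move (hf.trans hn.symm)) (Ne.symm ht), hf⟩⟩

/-- In an infinite run for `pl`, a maximal variable that is visited infinitely often is not one
that `pl` has to unfold. -/
theorem unfolder_ne_of_maximal (hφ : φ.Clean) (h₀ : (s 0).Good V e φ pl)
    (hs : ∀ n, (s n).Step V e φ pl (s (n + 1))) {z : X ⊕ Y}
    (hz : z ∈ infVars φ fun n => (s n).pos)
    (hmax : ∀ w ∈ infVars φ fun n => (s n).pos, φ.Dep z w → w = z) : unfolder z ≠ pl := by
  intro hpl
  obtain ⟨χ, hχ⟩ := hz.1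
  obtain ⟨N, hN⟩ := Filter.eventually_atTop.1
    ((isTrace_of_steps hφ h₀ hs).eventually_mem_subformulas_fix hφ hχ hz hmax)
  -- Two earlier moves below the binder are needed: one shows that the predecessor is `var z` or a
  -- preliminary position at the binder, the other excludes the latter.
  have hdrop : ∀ n ≥ N + 2, (s n).pos.IsFix z χ → (s (n + 1)).rank z < (s n).rank z := by
    intro n hn hfix
    obtain ⟨k, rfl⟩ : ∃ k, n = k + 2 := ⟨n - 2, by omega⟩
    have hvar : (s (k + 1)).pos.IsVar z := by
      rcases (isFix_of_move hφ (hs (k + 1)).move hfix.2 (hN (k + 1) (by omega))).2 with h | ⟨h, h'⟩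
      · exact h
      · exact absurd (isFix_of_move hφ (hs k).move h (hN k (by omega))).1 h'
    have hg := good_of_steps h₀ hs (k + 1)
    have hsat := hg.sat
    have ha := hg.active z χ (hvar.2 ▸ .free (Set.mem_singleton z) ⟨χ, hχ⟩) hχ
    obtain ⟨he, hr⟩ := (hs (k + 1)).same fun w θ => hvar.not_isFix
    obtain ⟨b', hm, -, hb'⟩ := hvar.moves_eq (F := F) (V := V) (e := e) hφ hχ
    have hmv := (hs (k + 1)).move
    rw [hm, Set.mem_singleton_iff] at hmv
    rw [hvar.2, show eval F V (.var z : Formula P X Y) (s (k + 1)).env = (s (k + 1)).env z from rfl,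
      ha, ← hb', ← hmv, ← he, ← hr] at hsat
    -- The environment and the rank are still those of the visit to `var z`, so an earlier stage `c`
    -- already works and the new rank is at most `c`.
    obtain ⟨c, hc, hsat'⟩ := hsat.exists_lt hfix.1 hpl
    exact ((hs (k + 2)).least z χ hfix c hsat').trans_lt hc
  have hstay : ∀ n ≥ N + 2, (s (n + 1)).rank z ≤ (s n).rank z := by
    intro n hn
    by_cases hfix : ∃ w θ, (s n).pos.IsFix w θ
    · obtain ⟨w, θ, hfix⟩ := hfix
      by_cases hw : z = w
      · subst hw
        have hθ : φ.IsBody z θ :=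
          (congrArg (· ∈ φ.subformulas) hfix.2).mp (good_of_steps h₀ hs n).mem
        rw [hφ.2 z θ χ hθ hχ] at hfix
        exact (hdrop n hn hfix).le
      · exact ((hs n).other w θ hfix z hw).le
    · push Not at hfix
      rw [((hs n).same hfix).2]
  -- From the stage where the rank of `z` is least it can never drop again, but `z` is unfolded once
  -- more.
  obtain ⟨n, hn, hmin⟩ := WellFounded.has_min
    (InvImage.wf (fun n => (s n).rank z) (wellFounded_lt (α := Ordinal))) (Set.Ici (N + 2))
    ⟨N + 2, Set.self_mem_Ici⟩
  obtain ⟨j, hj, hjz⟩ := Filter.frequently_atTop.1 hz.2 n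
  obtain ⟨k, hk, hfix⟩ := exists_isFix_of_var hφ hs hχ hjz
  have hle : ∀ k ≥ n, (s k).rank z ≤ (s n).rank z := by
    intro k hk
    induction k, hk using Nat.le_induction with
    | base => exact le_rfl
    | succ k hk ih => exact (hstay k (le_trans hn hk)).trans ih
  have hnk : n ≤ k := hj.trans hk
  have hNk : N + 2 ≤ k := le_trans hn hnk
  exact hmin (k + 1) (Set.mem_Ici.2 (by omega)) ((hdrop k hNk hfix).trans_le (hle k hnk))

/-- An infinite run for `∃` visits some bound variable infinitely often. -/
theorem nonempty_infVars_of_eloisa (hφ : φ.Clean) (h₀ : (s 0).Good V e φ .eloisa)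
    (hs : ∀ n, (s n).Step V e φ .eloisa (s (n + 1))) : (infVars φ fun n => (s n).pos).Nonempty := by
  rw [Set.nonempty_iff_ne_empty]
  intro hemp
  obtain ⟨N, hN⟩ := (isTrace_of_steps hφ h₀ hs).eventually_const hemp
  -- With the formula constant the turn alternates, so `∀` would be to move at a true position while
  -- the formula is kept twice.
  have key : ∀ n ≥ N, (s n).pos.turn ≠ .abelard := by
    intro n hn ht
    have hg := good_of_steps h₀ hs n
    exact formula_ne_of_two_moves hg.env_eq ht hg.sat (hs n).move (hs (n + 1)).move (hN n hn)
      (hN (n + 1) (hn.trans n.le_succ))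
  exact turn_ne_of_move_of_formula_eq (hs N).move (hN N le_rfl)
    (Player.eq_of_ne_of_ne (key (N + 1) N.le_succ) (key N le_rfl))

/-- Only `∃` needs a recurring variable to exist, since a play without one is won by `∀`. -/
theorem winsInf_of_steps (hφ : φ.Clean) (h₀ : (s 0).Good V e φ pl)
    (hs : ∀ n, (s n).Step V e φ pl (s (n + 1))) :
    (evalGame F V e φ).WinsInf pl fun n => (s n).pos := by
  cases pl with
  | eloisa =>
    obtain ⟨z, hz, hmax⟩ := hφ.exists_maximal (fun _ h => h.1) (nonempty_infVars_of_eloisa hφ h₀ hs)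
    cases z with
    | inl x => exact ⟨x, hz, hmax⟩
    | inr y => exact absurd rfl (unfolder_ne_of_maximal hφ h₀ hs hz hmax)
  | abelard =>
    rintro ⟨x, hz, hmax⟩
    exact unfolder_ne_of_maximal hφ h₀ hs hz hmax rfl

/-- The player who defends the truth value of `φ` at a position has a winning strategy from it. -/
theorem hasWinningStrategy_of_sat (hφ : φ.Clean) {b : Position G M P X Y} (hb : b.formula = φ)
    (h : b.Sat (eval F V φ e) pl) : (evalGame F V e φ).HasWinningStrategy pl b := by
  refine (evalGame F V e φ).hasWinningStrategy_of_simulation GameState.pos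
    (GameState.Good V e φ pl) (GameState.Step V e φ pl) (fun _ _ h => h.move) (fun _ _ h => h.good)
    (fun _ h => h.exists_step_of_turn hφ) (fun _ h ht _ hb => h.exists_step_of_turn_ne hφ ht hb)
    (fun _ => winsInf_of_steps hφ) ⟨b, e, fun _ => 0⟩ ⟨?_, ?_, fun _ _ => rfl, ?_⟩
  · exact hb ▸ Formula.mem_subformulas_self b.formula
  · exact hb ▸ h
  · exact fun z χ hz _ => absurd (hb ▸ hz) hφ.not_active_self

theorem holds_iff_hasWinningStrategy (hφ : φ.Clean) {b : Position G M P X Y} (hb : b.formula = φ) :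
    b.Holds (eval F V φ e) ↔ (evalGame F V e φ).HasWinningStrategy .eloisa b :=
  ⟨fun h => hasWinningStrategy_of_sat hφ hb h, fun h => not_not.1 fun hn =>
    (evalGame F V e φ).not_hasWinningStrategy_both b h (hasWinningStrategy_of_sat hφ hb hn)⟩

end States

end NDMu

theorem mainTheorem1 {G M P X Y : Type*} [DecidableEq X] [DecidableEq Y]
    (F : NDMu.EnrichedPolarity G M) (V : P → F.Lat) (e : X ⊕ Y → F.Lat)
    (φ : NDMu.Formula P X Y) (hφ : φ.Clean) :
    (∀ g : G, NDMu.Forces F V e g φ ↔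
      (NDMu.evalGame F V e φ).HasWinningStrategy .eloisa (.obj g φ)) ∧
    (∀ m : M, ¬ NDMu.Refutes F V e m φ ↔
      (NDMu.evalGame F V e φ).HasWinningStrategy .eloisa (.feat m φ)) :=
  ⟨fun g => NDMu.holds_iff_hasWinningStrategy (b := .obj g φ) hφ rfl,
    fun m => NDMu.holds_iff_hasWinningStrategy (b := .feat m φ) hφ rfl⟩
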